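/- **Weighted Sobolev-type and Poincaré inequalities on a split domain.** Let $N\ge 2$, $p>2$, $\frac{p-2}{p-1}<r<1$ and $t=\frac{p-1}{p-2}\,r$ (so $t>1$). Let $\gamma=0$ if $N=2$ and $N-2t<\gamma<N-2$ if $N\ge 3$. Put $(2t)'=\frac{2t}{2t-1}$, $$\frac1{2^*(t)}=\frac12-\frac1N+\frac1t\Big(\frac12-\frac{\gamma}{2N}\Big),\qquad \mu=1-\frac1N\Big(N-1-\frac{\gamma}{2t}\Big)(2t)' ,$$ and let $\omega_N$ be the volume of the unit ball of $\mathbb R^N$. *Setting.* Let $\Omega\subset\mathbb R^N$ be open with $|\Omega|<\infty$, and let $\Omega_1,\Omega_2\subset\Omega$ be disjoint measurable sets with $|\Omega\setminus(\Omega_1\cup\Omega_2)|=0$. Let $\rho\ge 0$ on $\Omega_1$ and $\eta\ge0$ on $\Omega_2$ be measurable weights and $C_1^*,C_2^*\ge 0$ constants such that, for every $x\in\Omega$, $$\int_{\Omega_1}\frac{dy}{\rho(y)^t|x-y|^\gamma}\le C_1^*,\qquad \int_{\Omega_2}\frac{dy}{\eta(y)^t|x-y|^\gamma}\le C_2^*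 .$$ Let $\sigma=\rho$ on $\Omega_1$ and $\sigma=\eta$ on $\Omega_2$. Let $H^{1,2}_\sigma(\Omega)$ be the space of functions $w\in L^2(\Omega)$ with a locally integrable distributional gradient $\nabla w$, $\int_\Omega\sigma|\nabla w|^2<\infty$, that are limits, for the norm $\|w\|_{L^2(\Omega)}+(\int_\Omega\sigma|\nabla w|^2)^{1/2}$, of functions in $C^1(\Omega)$; let $H^{1,2}_{0,\sigma}(\Omega)$ be the space of those that are limits of functions in $C^1_c(\Omega)$. Let $w$ and $\hat C$ be as in one of the following cases: 1. $w\in H^{1,2}_{0,\sigma}(\Omega)$ and $\hat C=\frac1{N\omega_N}$; 2. $\Omega$ is convex and bounded, $w\in H^{1,2}_{\sigma}(\Omega)$, $\int_S w=0$ for some measurable $S\subset\Omega$ with $|S|>0$, and $\hat C=\frac{(\operatorname{diam}\Omega)^N}{N|S|}$; 3. $w\in H^{1,2}_{\sigma}(\Omega)$, $\hat C\ge 0$ and $|w(x)|\le\hat C\int_\Omega\frac{|\nabla w(y)|}{|x-y|^{N-1}}\,dy$ for a.e. $x\in\Omega$. For $1\le q<2^*(t)$ put $\delta=(2t)'\big(\frac12-\frac1q\big)$,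 $\delta^+=\max\{\delta,0\}$ (so $\delta^+=\delta$ if $q\ge2$), and $$C_M=C_M(q)=\Big(\frac{1-\delta^+}{\mu-\delta^+}\Big)^{1-\delta^+}\omega_N^{1-\mu}\,|\Omega|^{\mu-\delta}.$$ (a) *Sobolev inequality.* In this setting, for every $1\le q<2^*(t)$, $$\|w\|_{L^q(\Omega)}\le C_{s_\rho}\Big(\int_{\Omega_1}\rho|\nabla w|^2\Big)^{1/2}+C_{s_\eta}\Big(\int_{\Omega_2}\eta|\nabla w|^2\Big)^{1/2},$$ with $C_{s_\rho}=\hat C\,(C_1^*)^{\frac1{2t}}\,C_M^{\frac1{(2t)'}}$ and $C_{s_\eta}=\hat C\,(C_2^*)^{\frac1{2t}}\,C_M^{\frac1{(2t)'}}$. (b) *Poincaré inequality.* One has $2^*(t)>2$, and for every $2<q<2^*(t)$ there is a function $C_p$ of $|\Omega|$, depending only on $N,p,r,\gamma,q$, with $C_p(|\Omega|)\to0$ as $|\Omega|\to0$, such that in this setting $$\int_\Omega w^2\le C_p(|\Omega|)\,\hat C^2\Big((C_1^*)^{\frac1t}C_M^{\frac2{(2t)'}}\int_{\Omega_1}\rho|\nabla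 w|^2+(C_2^*)^{\frac1t}C_M^{\frac2{(2t)'}}\int_{\Omega_2}\eta|\nabla w|^2\Big),\qquad C_M=C_M(q).$$ (c) *Rate.* For every $0<\theta<1$ there are $C>0$, $r_0<1$ and $\gamma_0<N-2$ (depending only on $N,p,\theta$) such that for all $r,\gamma$ as above with $r>r_0$ and $\gamma>\gamma_0$, there is $q\in(2,2^*(t))$ for which the inequality in (b) holds, in this setting, with $C_p(|\Omega|)=C\,|\Omega|^{\frac{2\theta}{(p-1)N}}$. -/

import Mathlib

open MeasureTheory Set Filter Topology

noncomputable section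

namespace WSobolev

/-- The Euclidean space `ℝ^N`. -/
abbrev E (N : ℕ) : Type := EuclideanSpace ℝ (Fin N)

/-- `ω_N`, the volume of the unit ball of `ℝ^N`. -/
def unitBallVol (N : ℕ) : ℝ := (volume (Metric.ball (0 : E N) 1)).toReal

/-- `G` is the distributional gradient of `w` on the open set `Ω`. -/
structure HasWeakGradient {N : ℕ} (Ω : Set (E N)) (w : E N → ℝ) (G : E N → E N) : Prop where
  locInt : LocallyIntegrableOn w Ω
  locInt_grad : LocallyIntegrableOn G Ω
  byParts : ∀ ψ : E N → ℝ, ContDiff ℝ (⊤ : ℕ∞) ψ → HasCompactSupport ψ → tsupport ψ ⊆ Ω →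
    ∀ v : E N, ∫ x in Ω, w x * fderiv ℝ ψ x v = - ∫ x in Ω, ψ x * inner ℝ (G x) v

/-- The weighted Dirichlet energy `∫_U σ |G|²`, with values in `[0, ∞]`. -/
def energy {N : ℕ} (U : Set (E N)) (σ : E N → ℝ) (G : E N → E N) : ENNReal :=
  ∫⁻ x in U, ENNReal.ofReal (σ x) * ‖G x‖ₑ ^ (2 : ℕ)

/-- `(w, ∇w)` lies in the closure, for the norm `‖w‖_{L²(Ω)} + ‖∇w‖_{L²(Ω, σ)}`, of the functions
of the class `T`. -/
structure MemClosure {N : ℕ} (T : Set (E N → ℝ)) (Ω : Set (E N)) (σ : E N → ℝ)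
    (w : E N → ℝ) (G : E N → E N) : Prop where
  memLp : MemLp w 2 (volume.restrict Ω)
  weakGradient : HasWeakGradient Ω w G
  energy_lt_top : energy Ω σ G < ⊤
  approx : ∃ φ : ℕ → E N → ℝ, (∀ n, φ n ∈ T) ∧
    Tendsto (fun n => eLpNorm (fun x => φ n x - w x) 2 (volume.restrict Ω)) atTop (𝓝 0) ∧
    Tendsto (fun n => energy Ω σ (fun x => gradient (φ n) x - G x)) atTop (𝓝 0)

/-- `w ∈ H^{1,2}_σ(Ω)` with gradient `G`: the closure of the functions of class `C¹` in `Ω` (of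
finite norm: the approximants have finite norm from some index on). -/
def MemH {N : ℕ} (Ω : Set (E N)) (σ : E N → ℝ) (w : E N → ℝ) (G : E N → E N) : Prop :=
  MemClosure {φ | ContDiffOn ℝ 1 φ Ω} Ω σ w G

/-- `w ∈ H^{1,2}_{0,σ}(Ω)` with gradient `G`: the closure of `C¹_c(Ω)`. -/
def MemH0 {N : ℕ} (Ω : Set (E N)) (σ : E N → ℝ) (w : E N → ℝ) (G : E N → E N) : Prop :=
  MemClosure {φ | ContDiff ℝ 1 φ ∧ HasCompactSupport φ ∧ tsupport φ ⊆ Ω} Ω σ w G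

/-- The weight equal to `ρ` on `Ω₁` and to `η` on `Ω₂` (disjoint sets). -/
def glue {N : ℕ} (Ω₁ Ω₂ : Set (E N)) (ρ η : E N → ℝ) : E N → ℝ :=
  fun x => Ω₁.indicator ρ x + Ω₂.indicator η x

/-- `|w(x)| ≤ Ĉ ∫_Ω |∇w(y)| |x - y|^{1-N} dy` for almost every `x ∈ Ω`. -/
def PotentialEstimate {N : ℕ} (Ω : Set (E N)) (w : E N → ℝ) (G : E N → E N) (Chat : ℝ) : Prop :=
  ∀ᵐ x ∂(volume.restrict Ω),
    ‖w x‖ₑ ≤ ENNReal.ofReal Chat * ∫⁻ y in Ω, ‖G y‖ₑ * ‖x - y‖ₑ ^ (1 - (N : ℝ))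

/-- The admissible functions `w` (with gradient `G`), together with the constant `Ĉ` attached to
them: functions vanishing on the boundary; functions on a convex set with mean zero over a subset
`S`; or functions satisfying the potential estimate with constant `Ĉ`. -/
def Admissible {N : ℕ} (Ω : Set (E N)) (σ : E N → ℝ) (w : E N → ℝ) (G : E N → E N)
    (Chat : ℝ) : Prop :=
  (MemH0 Ω σ w G ∧ Chat = 1 / (N * unitBallVol N)) ∨
  (MemH Ω σ w G ∧ Convex ℝ Ω ∧ Bornology.IsBounded Ω ∧
    ∃ S : Set (E N), MeasurableSet S ∧ S ⊆ Ω ∧ volume S ≠ 0 ∧ (∫ x in S, w x) = 0 ∧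
      Chat = Metric.diam Ω ^ N / (N * (volume S).toReal)) ∨
  (MemH Ω σ w G ∧ 0 ≤ Chat ∧ PotentialEstimate Ω w G Chat)

/-- `t = (p-1)/(p-2) · r`. -/
def texp (p r : ℝ) : ℝ := (p - 1) / (p - 2) * r

/-- The standing conditions on `r` and `γ`. -/
structure Exponents (N : ℕ) (p r γ : ℝ) : Prop where
  lower_r : (p - 2) / (p - 1) < r
  upper_r : r < 1
  two : N = 2 → γ = 0
  upper_γ : 3 ≤ N → γ < N - 2
  lower_γ : 3 ≤ N → N - 2 * texp p r < γ

/-- `2^*(t)`, given by `1/2^*(t) = 1/2 - 1/N + (1/t)(1/2 - γ/(2N))`. -/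
def twoStar (N : ℕ) (t γ : ℝ) : ℝ :=
  (1 / 2 - 1 / (N : ℝ) + 1 / t * (1 / 2 - γ / (2 * N)))⁻¹

/-- `(2t)'`, the exponent conjugate to `2t`. -/
def conj2 (t : ℝ) : ℝ := 2 * t / (2 * t - 1)

/-- `α/N = 1 - (1/N)(N - 1 - γ/(2t)) (2t)'`. -/
def muexp (N : ℕ) (t γ : ℝ) : ℝ := 1 - 1 / (N : ℝ) * (N - 1 - γ / (2 * t)) * conj2 t

/-- `δ = (2t)'/2 - (2t)'/q`. -/
def deltaexp (t q : ℝ) : ℝ := conj2 t * (1 / 2 - 1 / q)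

/-- The constant `C_M`, as a function of the exponents and of the volume `V = |Ω|`. For `q ≥ 2` one
has `max δ 0 = δ`, and `C_M = ((1-δ)/(α/N-δ))^{1-δ} ω_N^{1-α/N} V^{α/N-δ}`. -/
def CM (N : ℕ) (t γ q V : ℝ) : ℝ :=
  ((1 - max (deltaexp t q) 0) / (muexp N t γ - max (deltaexp t q) 0)) ^ (1 - max (deltaexp t q) 0)
    * unitBallVol N ^ (1 - muexp N t γ) * V ^ (muexp N t γ - deltaexp t q)

/-- The constant `Ĉ C^{1/(2t)} C_M^{1/(2t)'}`. -/
def Cs (N : ℕ) (t γ q V Chat C : ℝ) : ℝ :=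
  Chat * C ^ (1 / (2 * t)) * CM N t γ q V ^ (1 / conj2 t)

/-- `∫_U ρ(y)^{-t} |x - y|^{-γ} dy ≤ C` for every `x ∈ Ω`; here `ρ(y)^{-t} = ∞` where `ρ(y) = 0`. -/
def WeightBound {N : ℕ} (Ω U : Set (E N)) (ρ : E N → ℝ) (t γ C : ℝ) : Prop :=
  ∀ x ∈ Ω, ∫⁻ y in U, ENNReal.ofReal (ρ y) ^ (-t) * ‖x - y‖ₑ ^ (-γ) ≤ ENNReal.ofReal C

/-- The open set `Ω` of finite measure, split up to a null set into the disjoint sets `Ω₁`, `Ω₂`,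
which carry the weights `ρ`, `η`. -/
structure WeightedSplitting {N : ℕ} (Ω Ω₁ Ω₂ : Set (E N)) (ρ η : E N → ℝ)
    (t γ C₁ C₂ : ℝ) : Prop where
  isOpen : IsOpen Ω
  finite_volume : volume Ω ≠ ⊤
  measurable₁ : MeasurableSet Ω₁
  measurable₂ : MeasurableSet Ω₂
  subset₁ : Ω₁ ⊆ Ω
  subset₂ : Ω₂ ⊆ Ω
  disjoint : Disjoint Ω₁ Ω₂
  null_remainder : volume (Ω \ (Ω₁ ∪ Ω₂)) = 0
  weight_measurable₁ : AEMeasurable ρ (volume.restrict Ω₁)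
  weight_measurable₂ : AEMeasurable η (volume.restrict Ω₂)
  weight_nonneg₁ : ∀ x ∈ Ω₁, 0 ≤ ρ x
  weight_nonneg₂ : ∀ x ∈ Ω₂, 0 ≤ η x
  const_nonneg₁ : 0 ≤ C₁
  const_nonneg₂ : 0 ≤ C₂
  bound₁ : WeightBound Ω Ω₁ ρ t γ C₁
  bound₂ : WeightBound Ω Ω₂ η t γ C₂

/-- The weighted Sobolev inequality
`‖w‖_{L^q(Ω)} ≤ C_{s_ρ} ‖∇w‖_{L²(Ω₁,ρ)} + C_{s_η} ‖∇w‖_{L²(Ω₂,η)}`. -/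
def SobolevIneq {N : ℕ} (Ω Ω₁ Ω₂ : Set (E N)) (ρ η : E N → ℝ) (t γ C₁ C₂ Chat q : ℝ)
    (w : E N → ℝ) (G : E N → E N) : Prop :=
  eLpNorm w (ENNReal.ofReal q) (volume.restrict Ω) ≤
    ENNReal.ofReal (Cs N t γ q (volume Ω).toReal Chat C₁) * energy Ω₁ ρ G ^ (1 / 2 : ℝ) +
    ENNReal.ofReal (Cs N t γ q (volume Ω).toReal Chat C₂) * energy Ω₂ η G ^ (1 / 2 : ℝ)

/-- The weighted Poincaré inequality `∫_Ω w² ≤ C_p(|Ω|) Ĉ² (C₁^{1/t} C_M^{2/(2t)'} ∫_{Ω₁} ρ|∇w|²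
+ C₂^{1/t} C_M^{2/(2t)'} ∫_{Ω₂} η|∇w|²)`, with `C_M` computed for the exponent `q`. -/
def PoincareIneq {N : ℕ} (Ω Ω₁ Ω₂ : Set (E N)) (ρ η : E N → ℝ) (t γ C₁ C₂ Chat q : ℝ)
    (Cp : ℝ → ℝ) (w : E N → ℝ) (G : E N → E N) : Prop :=
  ∫⁻ x in Ω, ‖w x‖ₑ ^ (2 : ℕ) ≤
    ENNReal.ofReal (Cp (volume Ω).toReal * Chat ^ 2) *
      (ENNReal.ofReal (C₁ ^ (1 / t) * CM N t γ q (volume Ω).toReal ^ (2 / conj2 t)) *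
          energy Ω₁ ρ G +
        ENNReal.ofReal (C₂ ^ (1 / t) * CM N t γ q (volume Ω).toReal ^ (2 / conj2 t)) *
          energy Ω₂ η G)

end WSobolev

end

noncomputable section

namespace WSobolev

/-! All three admissible cases reduce to one pointwise estimate: `|w|` is at most `Ĉ` times the
potential `∫ |∇w(y)| |x - y|^{1-N} dy`. The theorem then becomes a weighted bound for this potential
operator.

For that bound, write `1 = ρ^{-1/2} ρ^{1/2}` and apply Hölder with exponents `2t` and `(2t)'`. The
weight hypothesis absorbs `ρ^{-t} |x - y|^{-γ}` uniformly in `x`. What remains is the Riesz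
potential with kernel `|x - y|^{N(μ-1)}`, applied to `(ρ^{1/2} |∇w|)^{(2t)'}`
(`weighted_potential_le_riesz`). On a set of finite volume it maps `L^{2/(2t)'}` to `L^{q/(2t)'}` as
soon as `δ < μ` (`riesz_potential_le`), and `δ < μ` is the condition `q < 2^*(t)`. Minkowski's
inequality adds up the two pieces of the domain.

The pointwise estimate for `C¹` functions comes from integrating the derivative along segments
issuing from `x` (`lintegral_rays_eq`). It survives the closure because the potential operator is
itself bounded from the weighted space into `L²` (`potentialEstimate_of_approx`).

For Poincaré, Hölder from `L^q` to `L²` gains `|Ω|^{1/2-1/q}`. The rate follows because `1 -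
2/2^*(t)` tends to `2/((p-1)N)` as `r → 1` and `γ → N - 2`. -/

/-! ### Balls and integrals of the singular kernel. -/

lemma unitBallVol_pos (N : ℕ) : 0 < unitBallVol N :=
  ENNReal.toReal_pos (Metric.measure_ball_pos volume 0 one_pos).ne' measure_ball_lt_top.ne

lemma volume_ball_eq {N : ℕ} (x : E N) {r : ℝ} (hr : 0 < r) :
    volume (Metric.ball x r) = ENNReal.ofReal (r ^ N * unitBallVol N) := by
  rw [Measure.addHaar_ball_of_pos volume x hr, ENNReal.ofReal_mul (by positivity), unitBallVol,
    ENNReal.ofReal_toReal measure_ball_lt_top.ne, finrank_euclideanSpace, Fintype.card_fin]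

lemma ae_ne_point {N : ℕ} (hN : 0 < N) (x : E N) (s : Set (E N)) :
    ∀ᵐ y ∂(volume.restrict s), x ≠ y := by
  have : Nonempty (Fin N) := ⟨⟨0, hN⟩⟩
  refine ae_restrict_of_ae ?_
  have : volume ({x} : Set (E N)) = 0 := measure_singleton x
  filter_upwards [compl_mem_ae_iff.2 this] with y hy h
  exact hy (by simp [h])

lemma enorm_sub_rpow_eq {N : ℕ} {x y : E N} (h : x ≠ y) (a : ℝ) :
    ‖x - y‖ₑ ^ a = ENNReal.ofReal (‖x - y‖ ^ a) := by
  have : 0 < ‖x - y‖ := norm_pos_iff.2 (sub_ne_zero.2 h)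
  rw [← ofReal_norm, ENNReal.ofReal_rpow_of_pos this]

/-- The integral of `|x - y|^{-a}` over a set is at most its integral over the ball around `x` of
the same volume. -/
theorem lintegral_enorm_sub_rpow_neg_le {N : ℕ} (hN : 0 < N) {Ω : Set (E N)}
    (hΩ : volume Ω ≠ ⊤) (x : E N) {a : ℝ} (ha : 0 < a) (haN : a < N) :
    ∫⁻ y in Ω, ‖x - y‖ₑ ^ (-a) ≤ ENNReal.ofReal
      (N / (N - a) * unitBallVol N ^ (a / N) * (volume Ω).toReal ^ (1 - a / N)) := by
  rcases eq_or_ne (volume Ω) 0 with h0 | h0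
  · rw [Measure.restrict_eq_zero.2 h0, lintegral_zero_measure]
    exact zero_le
  set V := (volume Ω).toReal with hV
  have hVpos : 0 < V := ENNReal.toReal_pos h0 hΩ
  have hVof : volume Ω = ENNReal.ofReal V := (ENNReal.ofReal_toReal hΩ).symm
  set ω := unitBallVol N with hω
  have hωpos : 0 < ω := unitBallVol_pos N
  have hNpos : (0 : ℝ) < N := Nat.cast_pos.2 hN
  -- Layer-cake formula: the superlevel set `{|x - y|^{-a} > s}` inside `Ω` has measure at most `V`
  -- and at most `ω s^{-N/a}`. The two bounds agree at `s = s₀`, so the first is used below `s₀` and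
  -- the second above it.
  set s₀ : ℝ := (ω / V) ^ (a / N) with hs₀
  have hs₀pos : 0 < s₀ := by positivity
  have hexp : -(N / a : ℝ) < -1 := by
    have : 1 < (N / a : ℝ) := (one_lt_div ha).2 haN
    linarith
  have e1 : ∫⁻ y in Ω, ‖x - y‖ₑ ^ (-a) = ∫⁻ y in Ω, ENNReal.ofReal (‖x - y‖ ^ (-a)) :=
    lintegral_congr_ae ((ae_ne_point hN x Ω).mono fun y hy => enorm_sub_rpow_eq hy _)
  have hmeas : Measurable fun y : E N => ‖x - y‖ ^ (-a) := by fun_prop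
  rw [e1, lintegral_eq_lintegral_meas_lt (volume.restrict Ω)
    (Eventually.of_forall fun y => by positivity) hmeas.aemeasurable,
    ← Ioc_union_Ioi_eq_Ioi hs₀pos.le]
  refine (lintegral_union_le _ _ _).trans ?_
  have b1 : ∫⁻ s in Ioc 0 s₀, volume.restrict Ω {y | s < ‖x - y‖ ^ (-a)} ≤
      ENNReal.ofReal (V * s₀) := by
    calc _ ≤ ∫⁻ s in Ioc 0 s₀, volume Ω :=
          lintegral_mono fun s => (measure_mono (subset_univ _)).trans_eq (by simp)
      _ = _ := by
          rw [setLIntegral_const, Real.volume_Ioc, sub_zero, hVof, ENNReal.ofReal_mul hVpos.le]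
  have b2 : ∫⁻ s in Ioi s₀, volume.restrict Ω {y | s < ‖x - y‖ ^ (-a)} ≤
      ENNReal.ofReal (ω * (-s₀ ^ (-(N / a : ℝ) + 1) / (-(N / a : ℝ) + 1))) := by
    calc _ ≤ ∫⁻ s in Ioi s₀, ENNReal.ofReal (ω * s ^ (-(N / a : ℝ))) := by
          refine setLIntegral_mono' measurableSet_Ioi fun s hs => ?_
          have hspos : 0 < s := hs₀pos.trans hs
          have hsub : {y : E N | s < ‖x - y‖ ^ (-a)} ⊆ Metric.ball x (s ^ (-(1 / a))) := by
            intro y hy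
            simp only [mem_ofPred_eq] at hy
            have hne : 0 < ‖x - y‖ := by
              rcases (norm_nonneg (x - y)).eq_or_lt with h | h
              · rw [← h, Real.zero_rpow (by linarith)] at hy
                exact absurd hy (not_lt.2 hspos.le)
              · exact h
            rw [Metric.mem_ball, dist_comm, dist_eq_norm]
            have := Real.rpow_lt_rpow_of_neg hspos hy (z := -(1 / a)) (by simp; positivity)
            rwa [← Real.rpow_mul hne.le, show -a * -(1 / a) = 1 by field_simp,
              Real.rpow_one] at this
          calc _ ≤ volume {y : E N | s < ‖x - y‖ ^ (-a)} := Measure.restrict_apply_le _ _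
            _ ≤ _ := measure_mono hsub
            _ = _ := by
              rw [volume_ball_eq x (by positivity), ← Real.rpow_mul_natCast hspos.le, mul_comm]
              congr 3
              field_simp
      _ = _ := by
          rw [← ofReal_integral_eq_lintegral_ofReal, integral_const_mul,
            integral_Ioi_rpow_of_lt hexp hs₀pos]
          · exact (integrableOn_Ioi_rpow_of_lt hexp hs₀pos).const_mul ω
          · exact (ae_restrict_mem measurableSet_Ioi).mono fun s hs => by
              have : 0 < s := hs₀pos.trans hs
              positivity
  refine (add_le_add b1 b2).trans_eq ?_
  have hb : 0 < (N / a : ℝ) - 1 := by linarith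
  have key : ω * s₀ ^ (-(N / a : ℝ)) = V := by
    rw [hs₀, ← Real.rpow_mul (by positivity), show a / N * -(N / a : ℝ) = -1 by field_simp,
      Real.rpow_neg_one]
    field_simp
  have e3 : ω * (-s₀ ^ (-(N / a : ℝ) + 1) / (-(N / a : ℝ) + 1)) = V * s₀ * (a / (N - a)) := by
    rw [Real.rpow_add hs₀pos, Real.rpow_one]
    have h2 : (N : ℝ) - a ≠ 0 := by linarith
    have h3 : -(N / a : ℝ) + 1 = -((N - a) / a) := by field_simp; ring
    rw [h3, neg_div_neg_eq, ← mul_div_assoc, ← mul_assoc, key]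
    field_simp
  have h2 : (0 : ℝ) < N - a := by linarith
  rw [e3, ← ENNReal.ofReal_add (by positivity) (by positivity)]
  congr 1
  have e4 : V * s₀ = ω ^ (a / N) * V ^ (1 - a / N) := by
    rw [hs₀, Real.div_rpow hωpos.le hVpos.le, Real.rpow_sub hVpos, Real.rpow_one]
    ring
  rw [mul_assoc (N / (N - a) : ℝ), ← e4]
  field_simp
  ring

/-! ### Integral operators and Riesz potentials on sets of finite volume. -/

/-- A kernel `k ≥ 0` with `∫ k(x, y)^s` bounded by `H` in each variable maps `L^p` to `L^q`, where
`1/s = 1 - 1/p + 1/q`. -/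
theorem lintegral_kernel_rpow_le {α β : Type*} [MeasurableSpace α] [MeasurableSpace β]
    {μ : Measure α} {ν : Measure β} [SFinite μ] [SFinite ν] {k : α → β → ENNReal}
    (hk : Measurable (Function.uncurry k)) {H : ENNReal} {p q s : ℝ} (hp : 1 ≤ p) (hpq : p ≤ q)
    (hs : s * (1 - (1 / p - 1 / q)) = 1)
    (h₁ : ∀ᵐ x ∂μ, ∫⁻ y, k x y ^ s ∂ν ≤ H) (h₂ : ∀ᵐ y ∂ν, ∫⁻ x, k x y ^ s ∂μ ≤ H)
    {g : β → ENNReal} (hg : AEMeasurable g ν) :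
    (∫⁻ x, (∫⁻ y, k x y * g y ∂ν) ^ q ∂μ) ^ (1 / q) ≤
      H ^ (1 - (1 / p - 1 / q)) * (∫⁻ y, g y ^ p ∂ν) ^ (1 / p) := by
  have hp0 : 0 < p := by linarith
  have hq0 : 0 < q := by linarith
  have hqi : 0 < 1 / q := by positivity
  have hδ : 0 ≤ 1 / p - 1 / q := sub_nonneg.2 (one_div_le_one_div_of_le hp0 hpq)
  have hp1 : 0 ≤ 1 - 1 / p := sub_nonneg.2 ((div_le_one hp0).2 hp)
  have hδ1 : 0 < 1 - (1 / p - 1 / q) := by linarith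
  have hs0 : 0 < s := by
    by_contra h
    nlinarith
  set I := ∫⁻ y, g y ^ p ∂ν with hI
  -- Hölder for `k g = (k^s g^p)^{1/q} (k^s)^{1-1/p} (g^p)^{1/p-1/q}`, whose three outer exponents
  -- add up to `1`. The last two factors integrate to constants independent of `x`.
  have pointwise : ∀ᵐ x ∂μ, ∫⁻ y, k x y * g y ∂ν ≤
      (∫⁻ y, k x y ^ s * g y ^ p ∂ν) ^ (1 / q) * (H ^ (1 - 1 / p) * I ^ (1 / p - 1 / q)) := by
    filter_upwards [h₁] with x hx
    have hkx : Measurable (k x) := hk.of_uncurry_left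
    have := ENNReal.lintegral_prod_norm_pow_le (μ := ν) (Finset.univ : Finset (Fin 3))
      (f := ![fun y => k x y ^ s * g y ^ p, fun y => k x y ^ s, fun y => g y ^ p])
      (p := ![1 / q, 1 - 1 / p, 1 / p - 1 / q])
      (by
        intro i _
        fin_cases i
        · exact (hkx.pow_const s).aemeasurable.mul (hg.pow_const p)
        · exact (hkx.pow_const s).aemeasurable
        · exact hg.pow_const p)
      (by
        simp only [Fin.sum_univ_three, Matrix.cons_val_zero, Matrix.cons_val_one, Matrix.cons_val]
        ring)
      (by
        intro i _
        fin_cases i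
        · exact hqi.le
        · exact hp1
        · exact hδ)
    simp only [Fin.prod_univ_three, Matrix.cons_val_zero, Matrix.cons_val_one,
      Matrix.cons_val] at this
    calc ∫⁻ y, k x y * g y ∂ν = _ := by
          refine lintegral_congr fun y => ?_
          show _ = (k x y ^ s * g y ^ p) ^ (1 / q) * (k x y ^ s) ^ (1 - 1 / p) *
            (g y ^ p) ^ (1 / p - 1 / q)
          rw [ENNReal.mul_rpow_of_nonneg _ _ hqi.le, ← ENNReal.rpow_mul, ← ENNReal.rpow_mul,
            ← ENNReal.rpow_mul, ← ENNReal.rpow_mul]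
          calc k x y * g y = k x y ^ (s * (1 / q) + s * (1 - 1 / p)) *
                g y ^ (p * (1 / q) + p * (1 / p - 1 / q)) := by
                rw [show s * (1 / q) + s * (1 - 1 / p) = 1 by linear_combination hs,
                  show p * (1 / q) + p * (1 / p - 1 / q) = 1 by field_simp; ring,
                  ENNReal.rpow_one, ENNReal.rpow_one]
            _ = _ := by
                rw [ENNReal.rpow_add_of_nonneg _ _ (by positivity) (by positivity),
                  ENNReal.rpow_add_of_nonneg _ _ (by positivity) (by positivity)]
                ring
      _ ≤ _ := this
      _ ≤ _ := by rw [mul_assoc]; gcongr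
  -- The remaining factor, raised to the power `q`, is linear in `k^s`: Tonelli and the bound in the
  -- other variable suffice.
  have hfub : ∫⁻ x, ∫⁻ y, k x y ^ s * g y ^ p ∂ν ∂μ ≤ H * I := by
    rw [lintegral_lintegral_swap]
    · calc ∫⁻ y, ∫⁻ x, k x y ^ s * g y ^ p ∂μ ∂ν ≤ ∫⁻ y, H * g y ^ p ∂ν := by
            refine lintegral_mono_ae ?_
            filter_upwards [h₂] with y hy
            rw [lintegral_mul_const _ (hk.of_uncurry_right.pow_const s)]
            gcongr
        _ = H * I := lintegral_const_mul'' _ (hg.pow_const p)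
    · exact (hk.pow_const s).aemeasurable.mul
        ((hg.pow_const p).comp_quasiMeasurePreserving Measure.quasiMeasurePreserving_snd)
  have hmeas : AEMeasurable (fun x => ∫⁻ y, k x y ^ s * g y ^ p ∂ν) μ :=
    AEMeasurable.lintegral_prod_right' (f := fun z : α × β => k z.1 z.2 ^ s * g z.2 ^ p)
      ((hk.pow_const s).aemeasurable.mul
        ((hg.pow_const p).comp_quasiMeasurePreserving Measure.quasiMeasurePreserving_snd))
  calc (∫⁻ x, (∫⁻ y, k x y * g y ∂ν) ^ q ∂μ) ^ (1 / q)
      ≤ (∫⁻ x, (∫⁻ y, k x y ^ s * g y ^ p ∂ν) *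
          (H ^ (1 - 1 / p) * I ^ (1 / p - 1 / q)) ^ q ∂μ) ^ (1 / q) := by
        refine ENNReal.rpow_le_rpow (lintegral_mono_ae ?_) hqi.le
        filter_upwards [pointwise] with x hx
        refine (ENNReal.rpow_le_rpow hx hq0.le).trans_eq ?_
        rw [ENNReal.mul_rpow_of_nonneg _ _ hq0.le, ← ENNReal.rpow_mul,
          show 1 / q * q = 1 by field_simp, ENNReal.rpow_one]
    _ ≤ (H * I * (H ^ (1 - 1 / p) * I ^ (1 / p - 1 / q)) ^ q) ^ (1 / q) := by
        rw [lintegral_mul_const'' _ hmeas]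
        gcongr
    _ = _ := by
        rw [ENNReal.mul_rpow_of_nonneg _ _ hqi.le, ENNReal.mul_rpow_of_nonneg _ _ hqi.le,
          ← ENNReal.rpow_mul _ q, show q * (1 / q) = 1 by field_simp, ENNReal.rpow_one,
          show 1 - (1 / p - 1 / q) = 1 / q + (1 - 1 / p) by ring,
          show I ^ (1 / p) = I ^ (1 / q + (1 / p - 1 / q)) by congr 1; ring,
          ENNReal.rpow_add_of_nonneg _ _ hqi.le hp1, ENNReal.rpow_add_of_nonneg _ _ hqi.le hδ]
        ring

/-- The Riesz potential of order `Nκ` maps `L^p` to `L^q` on sets of finite volume, for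
`0 ≤ 1/p - 1/q < κ`. -/
theorem riesz_potential_le {N : ℕ} (hN : 0 < N) {Ω : Set (E N)} (hΩ : volume Ω ≠ ⊤)
    {U : Set (E N)} (hU : U ⊆ Ω) {κ p q : ℝ} (hκ : κ < 1) (hp : 1 ≤ p) (hpq : p ≤ q)
    (hδ : 1 / p - 1 / q < κ) {g : E N → ENNReal} (hg : AEMeasurable g (volume.restrict U)) :
    (∫⁻ x in Ω, (∫⁻ y in U, ‖x - y‖ₑ ^ (N * (κ - 1)) * g y) ^ q) ^ (1 / q) ≤
      ENNReal.ofReal (((1 - (1 / p - 1 / q)) / (κ - (1 / p - 1 / q))) ^ (1 - (1 / p - 1 / q)) *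
        unitBallVol N ^ (1 - κ) * (volume Ω).toReal ^ (κ - (1 / p - 1 / q))) *
      (∫⁻ y in U, g y ^ p) ^ (1 / p) := by
  set δ := 1 / p - 1 / q with hδdef
  have hp0 : 0 < p := by linarith
  have hδ0 : 0 ≤ δ := sub_nonneg.2 (one_div_le_one_div_of_le hp0 hpq)
  have hδ1 : 0 < 1 - δ := by linarith
  have hδκ : 0 < κ - δ := by linarith
  have hκ1 : 0 < 1 - κ := by linarith
  have hN0 : (0 : ℝ) < N := Nat.cast_pos.2 hN
  have hω := unitBallVol_pos N
  set V := (volume Ω).toReal with hV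
  have hV0 : 0 ≤ V := ENNReal.toReal_nonneg
  -- The kernel raised to the power `s = 1/(1-δ)` is `|x - y|^{-a}`; the hypothesis `δ < κ` says
  -- exactly that `a < N`, i.e. that this power is integrable near the diagonal.
  set a : ℝ := N * ((1 - κ) / (1 - δ)) with ha
  have ha0 : 0 < a := by positivity
  have haN : a < N := by
    rw [ha]
    have : (1 - κ) / (1 - δ) < 1 := (div_lt_one hδ1).2 (by linarith)
    nlinarith
  have haN' : a / N = (1 - κ) / (1 - δ) := by rw [ha]; field_simp
  set H : ℝ := N / (N - a) * unitBallVol N ^ (a / N) * V ^ (1 - a / N) with hH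
  have hNa : (0 : ℝ) < N - a := by linarith
  have hH0 : 0 ≤ H := by positivity
  have hk : Measurable (Function.uncurry fun x y : E N => ‖x - y‖ₑ ^ ((N : ℝ) * (κ - 1))) := by
    simp only [Function.uncurry_def]
    fun_prop
  have hexp : (N : ℝ) * (κ - 1) * (1 / (1 - δ)) = -a := by rw [ha]; field_simp; ring
  have bound : ∀ x : E N, ∫⁻ y in Ω, (‖x - y‖ₑ ^ ((N : ℝ) * (κ - 1))) ^ (1 / (1 - δ)) ≤
      ENNReal.ofReal H := fun x => by
    simp only [← ENNReal.rpow_mul, hexp]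
    exact lintegral_enorm_sub_rpow_neg_le hN hΩ x ha0 haN
  refine (lintegral_kernel_rpow_le hk hp hpq (s := 1 / (1 - δ)) (H := ENNReal.ofReal H)
    (by rw [← hδdef]; field_simp)
    (Eventually.of_forall fun x => (lintegral_mono_set hU).trans (bound x))
    (Eventually.of_forall fun y => ?_) hg).trans_eq ?_
  · simp only [enorm_sub_rev _ y]
    exact bound y
  · rw [← hδdef, ENNReal.ofReal_rpow_of_nonneg hH0 hδ1.le]
    congr 2
    have e1 : (N : ℝ) / (N - a) = (1 - δ) / (κ - δ) := by
      have : (N : ℝ) - a = N * ((κ - δ) / (1 - δ)) := by rw [ha]; field_simp; ring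
      rw [this]
      field_simp
    rw [hH, e1, haN', Real.mul_rpow (by positivity) (by positivity),
      Real.mul_rpow (by positivity) (by positivity), ← Real.rpow_mul hω.le, ← Real.rpow_mul hV0]
    congr 3
    · field_simp
    · field_simp
      ring

/-! ### Relations between the exponents. -/

lemma conj2_pos {t : ℝ} (ht : 1 < t) : 0 < conj2 t :=
  div_pos (by linarith) (by linarith)

lemma conj2_lt_two {t : ℝ} (ht : 1 < t) : conj2 t < 2 :=
  (div_lt_iff₀ (by linarith)).2 (by linarith)

lemma holderConjugate_conj2 {t : ℝ} (ht : 1 < t) : (2 * t).HolderConjugate (conj2 t) := by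
  have : 2 * t - 1 ≠ 0 := by linarith
  rw [Real.holderConjugate_iff]
  refine ⟨by linarith, ?_⟩
  rw [conj2]
  field_simp
  ring

lemma muexp_eq {N : ℕ} (hN : 2 ≤ N) {t γ : ℝ} (ht : 1 < t) :
    muexp N t γ = (γ + 2 * t - N) / (N * (2 * t - 1)) := by
  have h1 : (N : ℝ) ≠ 0 := by positivity
  have h2 : 2 * t - 1 ≠ 0 := by linarith
  rw [muexp, conj2]
  field_simp
  ring

lemma muexp_pos {N : ℕ} (hN : 2 ≤ N) {t γ : ℝ} (ht : 1 < t) (hγ : N - 2 * t < γ) :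
    0 < muexp N t γ := by
  have h1 : (0 : ℝ) < N := by positivity
  rw [muexp_eq hN ht]
  exact div_pos (by linarith) (mul_pos h1 (by linarith))

lemma muexp_lt_one {N : ℕ} (hN : 2 ≤ N) {t γ : ℝ} (ht : 1 < t) (hγ : γ ≤ N - 2) :
    muexp N t γ < 1 := by
  have h1 : (2 : ℝ) ≤ N := by exact_mod_cast hN
  rw [muexp_eq hN ht, div_lt_one (mul_pos (by linarith) (by linarith))]
  nlinarith

/-- In this form `q < 2^*(t)` reads `δ < μ`, the condition under which the Riesz potential is
bounded. -/
lemma inv_twoStar {N : ℕ} (hN : 2 ≤ N) {t γ : ℝ} (ht : 1 < t) :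
    (twoStar N t γ)⁻¹ = 1 / 2 - muexp N t γ / conj2 t := by
  have h1 : (N : ℝ) ≠ 0 := by positivity
  have h2 : 2 * t - 1 ≠ 0 := by linarith
  have h3 : t ≠ 0 := by linarith
  rw [muexp_eq hN ht, twoStar, conj2, inv_inv]
  field_simp
  ring

/-- `twoStar` is defined as an inverse, so comparing it with `q` through reciprocals requires its
sign. Here `1/2 - 1/N ≥ 0`, and the other term is positive since `γ < N`. -/
lemma inv_twoStar_pos {N : ℕ} (hN : 2 ≤ N) {t γ : ℝ} (ht : 1 < t) (hγ : γ ≤ N - 2) :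
    0 < (twoStar N t γ)⁻¹ := by
  have h1 : (2 : ℝ) ≤ N := by exact_mod_cast hN
  rw [twoStar, inv_inv]
  have h2 : 1 / (N : ℝ) ≤ 1 / 2 := one_div_le_one_div_of_le two_pos h1
  have h3 : 0 < 1 / 2 - γ / (2 * N) := by
    rw [sub_pos, div_lt_div_iff₀ (by linarith) (by linarith)]
    linarith
  have : 0 < 1 / t * (1 / 2 - γ / (2 * N)) := by positivity
  linarith

lemma two_lt_twoStar {N : ℕ} (hN : 2 ≤ N) {t γ : ℝ} (ht : 1 < t) (hγ : N - 2 * t < γ)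
    (hγ' : γ ≤ N - 2) : 2 < twoStar N t γ := by
  have h := inv_twoStar_pos hN ht hγ'
  have h2 : (twoStar N t γ)⁻¹ < 2⁻¹ := by
    rw [inv_twoStar hN ht]
    have := div_pos (muexp_pos hN ht hγ) (conj2_pos ht)
    linarith
  exact (inv_lt_inv₀ (inv_pos.1 h) two_pos).1 h2

lemma deltaexp_lt_muexp {N : ℕ} (hN : 2 ≤ N) {t γ q : ℝ} (ht : 1 < t) (hq : 1 ≤ q)
    (hqt : q < twoStar N t γ) : deltaexp t q < muexp N t γ := by
  have h := (inv_lt_inv₀ (by linarith) (by linarith)).2 hqt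
  rw [inv_twoStar hN ht] at h
  have h2 : 1 / 2 - 1 / q < muexp N t γ / conj2 t := by rw [one_div q]; linarith
  rw [lt_div_iff₀ (conj2_pos ht)] at h2
  rw [deltaexp]
  linarith

lemma CM_nonneg {N : ℕ} (hN : 2 ≤ N) {t γ q V : ℝ} (ht : 1 < t) (hγ : N - 2 * t < γ)
    (hq : 1 ≤ q) (hqt : q < twoStar N t γ) (hμ : muexp N t γ < 1) (hV : 0 ≤ V) :
    0 ≤ CM N t γ q V := by
  have h1 : max (deltaexp t q) 0 < muexp N t γ :=
    max_lt (deltaexp_lt_muexp hN ht hq hqt) (muexp_pos hN ht hγ)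
  have h2 : 0 ≤ (1 - max (deltaexp t q) 0) / (muexp N t γ - max (deltaexp t q) 0) :=
    div_nonneg (by linarith) (by linarith)
  have := (unitBallVol_pos N).le
  unfold CM
  positivity

/-! ### The weighted potential operator. -/

/-- Hölder's inequality with the weight `ρ`, at a point `x` where the weight bound holds. -/
lemma weighted_potential_le_riesz {N : ℕ} (hN : 2 ≤ N) {U : Set (E N)} {ρ : E N → ℝ}
    {t γ C : ℝ} (ht : 1 < t) (hρ : AEMeasurable ρ (volume.restrict U)) {x : E N}
    (hC : ∫⁻ y in U, ENNReal.ofReal (ρ y) ^ (-t) * ‖x - y‖ₑ ^ (-γ) ≤ ENNReal.ofReal C)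
    {F : E N → ENNReal} (hF : AEMeasurable F (volume.restrict U)) :
    ∫⁻ y in U, F y * ‖x - y‖ₑ ^ (1 - (N : ℝ)) ≤
      ENNReal.ofReal C ^ (1 / (2 * t)) *
        (∫⁻ y in U, ‖x - y‖ₑ ^ (N * (muexp N t γ - 1)) *
          (ENNReal.ofReal (ρ y) ^ (1 / 2 : ℝ) * F y) ^ conj2 t) ^ (1 / conj2 t) := by
  have ht0 : 0 < 2 * t := by linarith
  have hm := conj2_pos ht
  have hN0 : (N : ℝ) ≠ 0 := by positivity
  have hwm : AEMeasurable (fun y => ENNReal.ofReal (ρ y) ^ (-t) * ‖x - y‖ₑ ^ (-γ))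
      (volume.restrict U) := by fun_prop
  -- Since `ρ^{-t} = ∞` where `ρ = 0`, finiteness of the weight integral forces `ρ > 0` almost
  -- everywhere; without this, `ρ^{-1/2} ρ^{1/2}` would be `∞ · 0 = 0` instead of `1`.
  have hpos : ∀ᵐ y ∂(volume.restrict U), ENNReal.ofReal (ρ y) ≠ 0 := by
    filter_upwards [ae_lt_top' hwm (hC.trans_lt ENNReal.ofReal_lt_top).ne,
      ae_ne_point (by omega) x U] with y hy hxy h0
    rw [h0, ENNReal.zero_rpow_of_neg (by linarith), ENNReal.top_mul] at hy
    · exact lt_irrefl _ hy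
    · rw [enorm_sub_rpow_eq hxy]
      have : 0 < ‖x - y‖ := norm_pos_iff.2 (sub_ne_zero.2 hxy)
      exact (ENNReal.ofReal_pos.2 (by positivity)).ne'
  -- The first factor takes `|x - y|^{-γ/(2t)}` from the kernel. The leftover power `1 - N +
  -- γ/(2t)`, multiplied by `(2t)'`, is `N(μ - 1)` by the definition of `μ`.
  have hmul := ENNReal.lintegral_mul_le_Lp_mul_Lq (volume.restrict U) (holderConjugate_conj2 ht)
    (f := fun y => (ENNReal.ofReal (ρ y) ^ (-t) * ‖x - y‖ₑ ^ (-γ)) ^ (1 / (2 * t)))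
    (g := fun y => ‖x - y‖ₑ ^ (1 - (N : ℝ) + γ / (2 * t)) *
      (ENNReal.ofReal (ρ y) ^ (1 / 2 : ℝ) * F y)) (by fun_prop) (by fun_prop)
  calc ∫⁻ y in U, F y * ‖x - y‖ₑ ^ (1 - (N : ℝ)) = _ := by
        refine lintegral_congr_ae ?_
        filter_upwards [hpos, ae_ne_point (by omega) x U] with y hy hxy
        have hxy0 : ‖x - y‖ₑ ≠ 0 := enorm_ne_zero.2 (sub_ne_zero.2 hxy)
        simp only [Pi.mul_apply]
        rw [ENNReal.mul_rpow_of_nonneg _ _ (by positivity), ← ENNReal.rpow_mul,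
          ← ENNReal.rpow_mul, show -t * (1 / (2 * t)) = -(1 / 2) by field_simp]
        calc F y * ‖x - y‖ₑ ^ (1 - (N : ℝ)) = F y * (ENNReal.ofReal (ρ y) ^ (-(1 / 2) + 1 / 2 : ℝ) *
              ‖x - y‖ₑ ^ (-γ * (1 / (2 * t)) + (1 - (N : ℝ) + γ / (2 * t)))) := by
              rw [show -γ * (1 / (2 * t)) + (1 - (N : ℝ) + γ / (2 * t)) = 1 - N by
                  field_simp; ring, neg_add_cancel, ENNReal.rpow_zero, one_mul]
          _ = _ := by
              rw [ENNReal.rpow_add _ _ hy ENNReal.ofReal_ne_top,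
                ENNReal.rpow_add _ _ hxy0 enorm_ne_top]
              ring
    _ ≤ _ := hmul
    _ ≤ _ := by
        gcongr
        · refine le_of_eq_of_le (lintegral_congr fun y => ?_) hC
          rw [← ENNReal.rpow_mul, one_div_mul_cancel ht0.ne', ENNReal.rpow_one]
        · rw [ENNReal.mul_rpow_of_nonneg _ _ hm.le, ← ENNReal.rpow_mul]
          refine le_of_eq ?_
          congr 2
          rw [muexp]
          field_simp
          ring

/-- The potential operator `F ↦ ∫_U F(y) |x - y|^{1-N} dy` maps `L²(U, ρ)` to `L^q(Ω)`. -/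
theorem weighted_potential_le {N : ℕ} (hN : 2 ≤ N) {Ω U : Set (E N)} (hΩo : IsOpen Ω)
    (hΩ : volume Ω ≠ ⊤) (hU : U ⊆ Ω) {ρ : E N → ℝ} {t γ C : ℝ} (ht : 1 < t)
    (hγ : N - 2 * t < γ) (hγ' : γ ≤ N - 2) (hρ : AEMeasurable ρ (volume.restrict U))
    (hC0 : 0 ≤ C) (hC : WeightBound Ω U ρ t γ C) {F : E N → ENNReal}
    (hF : AEMeasurable F (volume.restrict U)) {q : ℝ} (hq : 1 ≤ q) (hqt : q < twoStar N t γ) :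
    (∫⁻ x in Ω, (∫⁻ y in U, F y * ‖x - y‖ₑ ^ (1 - (N : ℝ))) ^ q) ^ (1 / q) ≤
      ENNReal.ofReal (C ^ (1 / (2 * t)) * CM N t γ q (volume Ω).toReal ^ (1 / conj2 t)) *
        (∫⁻ y in U, ENNReal.ofReal (ρ y) * F y ^ (2 : ℕ)) ^ (1 / 2 : ℝ) := by
  have hμ1 := muexp_lt_one hN ht hγ'
  have hm := conj2_pos ht
  have ht0 : 0 < 2 * t := by linarith
  have hV0 : 0 ≤ (volume Ω).toReal := ENNReal.toReal_nonneg
  -- For `q < 2`, Hölder on `Ω` reduces to the exponent `2` at the cost of `|Ω|^{1/q-1/2}`. As `δ ≤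
  -- 0` there, `δ⁺ = 0` and `C_M(q) = C_M(2) |Ω|^{-δ}`, which accounts exactly for this factor.
  wlog hq2 : 2 ≤ q generalizing q with H
  · push Not at hq2
    rcases eq_or_ne (volume Ω) 0 with h0 | h0
    · rw [Measure.restrict_eq_zero.2 h0, lintegral_zero_measure,
        ENNReal.zero_rpow_of_pos (by positivity)]
      exact zero_le
    have hVpos : 0 < (volume Ω).toReal := ENNReal.toReal_pos h0 hΩ
    have h2t := two_lt_twoStar hN ht hγ hγ'
    have hT : AEMeasurable (fun x => ∫⁻ y in U, F y * ‖x - y‖ₑ ^ (1 - (N : ℝ)))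
        (volume.restrict Ω) := by
      refine AEMeasurable.lintegral_prod_right'
        (f := fun z : E N × E N => F z.2 * ‖z.1 - z.2‖ₑ ^ (1 - (N : ℝ))) ?_
      exact (hF.comp_quasiMeasurePreserving Measure.quasiMeasurePreserving_snd).mul
        (Measurable.aemeasurable (by fun_prop))
    have hh := eLpNorm'_le_eLpNorm'_mul_rpow_measure_univ (μ := volume.restrict Ω)
      (p := q) (q := 2) (by linarith) hq2.le hT.aestronglyMeasurable
    simp only [eLpNorm', enorm_eq_self, Measure.restrict_apply_univ] at hh
    refine hh.trans ((mul_le_mul_left (H one_le_two h2t le_rfl) _).trans_eq ?_)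
    rw [mul_right_comm]
    congr 1
    have hCM2 := CM_nonneg hN ht hγ one_le_two h2t hμ1 hV0
    rw [← ENNReal.ofReal_toReal hΩ, ENNReal.ofReal_rpow_of_pos hVpos,
      ENNReal.toReal_ofReal hV0, ← ENNReal.ofReal_mul (by positivity)]
    congr 1
    rw [mul_assoc]
    congr 1
    have hd2 : deltaexp t 2 = 0 := by simp [deltaexp]
    have hdq : deltaexp t q ≤ 0 := by
      refine mul_nonpos_of_nonneg_of_nonpos hm.le (sub_nonpos.2 ?_)
      exact one_div_le_one_div_of_le (by linarith) hq2.le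
    have e : CM N t γ q (volume Ω).toReal =
        CM N t γ 2 (volume Ω).toReal * (volume Ω).toReal ^ (-deltaexp t q) := by
      rw [CM, CM, hd2, max_self, max_eq_right hdq, mul_assoc _ _ (_ ^ (-deltaexp t q)),
        ← Real.rpow_add hVpos, sub_zero, sub_zero, sub_eq_add_neg (muexp N t γ) (deltaexp t q)]
    rw [e, Real.mul_rpow hCM2 (by positivity), ← Real.rpow_mul hV0]
    congr 2
    rw [deltaexp]
    field_simp
    ring
  · have hq0 : 0 < q := by linarith
    have hδ : 1 / (2 / conj2 t) - 1 / (q / conj2 t) = deltaexp t q := by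
      rw [deltaexp]
      field_simp
    have hδ0 : 0 ≤ deltaexp t q :=
      mul_nonneg hm.le (sub_nonneg.2 (one_div_le_one_div_of_le two_pos hq2))
    have hg : AEMeasurable (fun y => (ENNReal.ofReal (ρ y) ^ (1 / 2 : ℝ) * F y) ^ conj2 t)
        (volume.restrict U) := by fun_prop
    -- The source exponent `2/(2t)'` is at least `1` because `(2t)' < 2`, and the gap between the
    -- reciprocals of the two exponents is `δ`.
    have hR := riesz_potential_le (by omega) hΩ hU hμ1
      ((one_le_div hm).2 (conj2_lt_two ht).le) (q := q / conj2 t) (by gcongr)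
      (by rw [hδ]; exact deltaexp_lt_muexp hN ht hq hqt) hg
    rw [hδ] at hR
    have hCM : ((1 - deltaexp t q) / (muexp N t γ - deltaexp t q)) ^ (1 - deltaexp t q) *
        unitBallVol N ^ (1 - muexp N t γ) * (volume Ω).toReal ^ (muexp N t γ - deltaexp t q) =
        CM N t γ q (volume Ω).toReal := by
      rw [CM, max_eq_left hδ0]
    rw [hCM] at hR
    have hCM0 := CM_nonneg hN ht hγ hq hqt hμ1 hV0
    set A : E N → ENNReal := fun x => ∫⁻ y in U, ‖x - y‖ₑ ^ (N * (muexp N t γ - 1)) *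
      (ENNReal.ofReal (ρ y) ^ (1 / 2 : ℝ) * F y) ^ conj2 t with hA
    have hAm : AEMeasurable A (volume.restrict Ω) := by
      refine AEMeasurable.lintegral_prod_right'
        (f := fun z : E N × E N => ‖z.1 - z.2‖ₑ ^ (N * (muexp N t γ - 1)) *
          (ENNReal.ofReal (ρ z.2) ^ (1 / 2 : ℝ) * F z.2) ^ conj2 t) ?_
      exact (Measurable.aemeasurable (by fun_prop)).mul
        (hg.comp_quasiMeasurePreserving Measure.quasiMeasurePreserving_snd)
    calc (∫⁻ x in Ω, (∫⁻ y in U, F y * ‖x - y‖ₑ ^ (1 - (N : ℝ))) ^ q) ^ (1 / q)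
        ≤ (∫⁻ x in Ω, (ENNReal.ofReal C ^ (1 / (2 * t)) * A x ^ (1 / conj2 t)) ^ q) ^ (1 / q) := by
          refine ENNReal.rpow_le_rpow (setLIntegral_mono' hΩo.measurableSet fun x hx => ?_)
            (by positivity)
          exact ENNReal.rpow_le_rpow (weighted_potential_le_riesz hN ht hρ (hC x hx) hF) hq0.le
      _ = ENNReal.ofReal C ^ (1 / (2 * t)) *
            ((∫⁻ x in Ω, A x ^ (q / conj2 t)) ^ (1 / (q / conj2 t))) ^ (1 / conj2 t) := by
          simp only [ENNReal.mul_rpow_of_nonneg _ _ hq0.le, ← ENNReal.rpow_mul]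
          rw [lintegral_const_mul'' _ (hAm.pow_const _), ENNReal.mul_rpow_of_nonneg _ _
            (by positivity), ← ENNReal.rpow_mul]
          congr 2
          · field_simp
          · congr 1
            ext x
            congr 1
            ring
          · field_simp
      _ ≤ ENNReal.ofReal C ^ (1 / (2 * t)) * (ENNReal.ofReal (CM N t γ q (volume Ω).toReal) *
            (∫⁻ y in U, ((ENNReal.ofReal (ρ y) ^ (1 / 2 : ℝ) * F y) ^ conj2 t) ^ (2 / conj2 t)) ^
              (1 / (2 / conj2 t))) ^ (1 / conj2 t) := by
          gcongr
      _ = _ := by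
          rw [ENNReal.mul_rpow_of_nonneg _ _ (by positivity), ← ENNReal.rpow_mul,
            ENNReal.ofReal_rpow_of_nonneg hC0 (by positivity),
            ENNReal.ofReal_rpow_of_nonneg hCM0 (by positivity), ← mul_assoc,
            ← ENNReal.ofReal_mul (by positivity)]
          congr 2
          · refine lintegral_congr fun y => ?_
            rw [← ENNReal.rpow_mul, mul_div_cancel₀ _ hm.ne',
              ENNReal.mul_rpow_of_nonneg _ _ (by norm_num), ← ENNReal.rpow_mul,
              one_div_mul_cancel two_ne_zero, ENNReal.rpow_one, ENNReal.rpow_two]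
          · field_simp

/-! ### Potential estimates for `C¹` functions. -/

lemma enorm_gradient {N : ℕ} (φ : E N → ℝ) (x : E N) :
    ‖gradient φ x‖ₑ = ‖fderiv ℝ φ x‖ₑ := by
  rw [gradient, LinearIsometryEquiv.enorm_map]

lemma measurable_gradient {N : ℕ} (φ : E N → ℝ) : Measurable (gradient φ) :=
  (LinearIsometryEquiv.continuous _).measurable.comp (measurable_fderiv ℝ φ)

lemma lintegral_Ici_rpow_neg_succ {N : ℕ} (hN : 0 < N) {b : ℝ} (hb : 0 < b) :
    ∫⁻ r in Ici b, ENNReal.ofReal (r ^ (-(N : ℝ) - 1)) =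
      ENNReal.ofReal (b ^ (-(N : ℝ)) / N) := by
  have hN0 : (0 : ℝ) < N := Nat.cast_pos.2 hN
  have h1 : -(N : ℝ) - 1 < -1 := by linarith
  rw [setLIntegral_congr Ioi_ae_eq_Ici.symm, ← ofReal_integral_eq_lintegral_ofReal,
    integral_Ioi_rpow_of_lt h1 hb, sub_add_cancel, neg_div_neg_eq]
  · exact integrableOn_Ioi_rpow_of_lt h1 hb
  · exact (ae_restrict_mem measurableSet_Ioi).mono fun s hs => by
      have : 0 < s := hb.trans hs
      positivity

/-- Integrating a function along all rays issuing from `x` amounts to integrating it against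
`|x - y|^{1-N}`. -/
theorem lintegral_rays_eq {N : ℕ} (hN : 0 < N) {V : E N → ENNReal} (hV : Measurable V)
    (x : E N) {d : ℝ} (hd : 0 < d) :
    ∫⁻ z in Metric.closedBall (0 : E N) d, ∫⁻ r in Ioi (0 : ℝ), V (x + r • z) * ‖z‖ₑ =
      ENNReal.ofReal (d ^ N / N) * ∫⁻ y, V y * ‖x - y‖ₑ ^ (1 - (N : ℝ)) := by
  have hN0 : (0 : ℝ) < N := Nat.cast_pos.2 hN
  -- Substitute `u = r z` for fixed `r`: the ball becomes `|u| ≤ r d`, the Jacobian is `r^{-N}` and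
  -- `|z| = |u|/r`. Integrating `r^{-N-1}` over `r ≥ |u|/d` then gives `d^N |u|^{-N} / N`.
  set Φ : ℝ → E N → ENNReal := fun r u =>
    {p : ℝ × E N | ‖p.2‖ ≤ p.1 * d}.indicator
      (fun p => V (x + p.2) * ‖p.2‖ₑ * ENNReal.ofReal (p.1 ^ (-(N : ℝ) - 1))) (r, u) with hΦ
  have hset : MeasurableSet {p : ℝ × E N | ‖p.2‖ ≤ p.1 * d} :=
    measurableSet_le (by fun_prop) (by fun_prop)
  have hΦm : Measurable (Function.uncurry Φ) :=
    Measurable.indicator (by fun_prop) hset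
  have hscale : ∀ r ∈ Ioi (0 : ℝ),
      ∫⁻ z in Metric.closedBall (0 : E N) d, V (x + r • z) * ‖z‖ₑ = ∫⁻ u, Φ r u := by
    intro r hr
    have hr : 0 < r := hr
    have hmap := Measure.map_addHaar_smul (volume : Measure (E N)) hr.ne'
    rw [finrank_euclideanSpace, Fintype.card_fin, abs_of_pos (by positivity)] at hmap
    have hvol : (volume : Measure (E N)) =
        ENNReal.ofReal (r ^ N) • Measure.map (r • ·) (volume : Measure (E N)) := by
      rw [hmap, smul_smul, ← ENNReal.ofReal_mul (by positivity), mul_inv_cancel₀ (by positivity),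
        ENNReal.ofReal_one, one_smul]
    have hΦr : Measurable (Φ r) := hΦm.of_uncurry_left
    conv_rhs => rw [hvol, lintegral_smul_measure, lintegral_map hΦr (by fun_prop)]
    rw [smul_eq_mul, ← lintegral_const_mul _ (f := fun a => Φ r (r • a))
      (hΦr.comp (measurable_const_smul r)),
      ← lintegral_indicator Metric.isClosed_closedBall.measurableSet]
    refine lintegral_congr fun z => ?_
    have hiff : ‖r • z‖ ≤ r * d ↔ z ∈ Metric.closedBall (0 : E N) d := by
      rw [norm_smul, Real.norm_of_nonneg hr.le, mem_closedBall_zero_iff]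
      exact mul_le_mul_iff_right₀ hr
    by_cases hz : z ∈ Metric.closedBall (0 : E N) d
    · rw [indicator_of_mem hz, hΦ]
      simp only
      rw [indicator_of_mem (show (r, r • z) ∈ {p : ℝ × E N | ‖p.2‖ ≤ p.1 * d} from hiff.2 hz)]
      simp only
      have e : ENNReal.ofReal (r ^ N) * (ENNReal.ofReal r * ENNReal.ofReal (r ^ (-(N : ℝ) - 1))) =
          1 := by
        rw [← ENNReal.ofReal_mul hr.le, ← ENNReal.ofReal_mul (by positivity),
          ← ENNReal.ofReal_one, ← Real.rpow_natCast]
        congr 1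
        calc r ^ (N : ℝ) * (r * r ^ (-(N : ℝ) - 1)) =
              r ^ (N : ℝ) * (r ^ (1 : ℝ) * r ^ (-(N : ℝ) - 1)) := by rw [Real.rpow_one]
          _ = 1 := by
              rw [← Real.rpow_add hr, ← Real.rpow_add hr]
              simp
      rw [enorm_smul, Real.enorm_of_nonneg hr.le]
      calc V (x + r • z) * ‖z‖ₑ = V (x + r • z) * ‖z‖ₑ * (ENNReal.ofReal (r ^ N) *
            (ENNReal.ofReal r * ENNReal.ofReal (r ^ (-(N : ℝ) - 1)))) := by rw [e, mul_one]
        _ = _ := by ring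
    · rw [indicator_of_notMem hz, hΦ]
      simp only
      rw [indicator_of_notMem (show (r, r • z) ∉ {p : ℝ × E N | ‖p.2‖ ≤ p.1 * d} from
        fun h => hz (hiff.1 h)), mul_zero]
  have hinner : ∀ u : E N, (0 : E N) ≠ u → ∫⁻ r in Ioi (0 : ℝ), Φ r u =
      ENNReal.ofReal (d ^ N / N) * (V (x + u) * ‖u‖ₑ ^ (1 - (N : ℝ))) := by
    intro u hu
    have hu0 : 0 < ‖u‖ := norm_pos_iff.2 hu.symm
    have hb : 0 < ‖u‖ / d := by positivity
    have e1 : ∀ r, Φ r u = (Ici (‖u‖ / d)).indicator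
        (fun r => V (x + u) * ‖u‖ₑ * ENNReal.ofReal (r ^ (-(N : ℝ) - 1))) r := by
      intro r
      simp only [hΦ, indicator, mem_ofPred_eq, mem_Ici, div_le_iff₀ hd]
    simp only [e1]
    rw [lintegral_indicator measurableSet_Ici, Measure.restrict_restrict measurableSet_Ici,
      inter_eq_left.2 (show Ici (‖u‖ / d) ⊆ Ioi (0 : ℝ) from fun r hr => hb.trans_le hr),
      lintegral_const_mul _ (by fun_prop), lintegral_Ici_rpow_neg_succ hN hb]
    have e2 : ENNReal.ofReal ((‖u‖ / d) ^ (-(N : ℝ)) / N) =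
        ENNReal.ofReal (d ^ N / N) * ‖u‖ₑ ^ (-(N : ℝ)) := by
      rw [← ofReal_norm, ENNReal.ofReal_rpow_of_pos hu0, ← ENNReal.ofReal_mul (by positivity)]
      congr 1
      rw [Real.div_rpow hu0.le hd.le, Real.rpow_neg hd.le, Real.rpow_natCast]
      field_simp
    rw [e2, sub_eq_add_neg, ENNReal.rpow_add _ _ (enorm_ne_zero.2 hu.symm) enorm_ne_top,
      ENNReal.rpow_one]
    ring
  rw [lintegral_lintegral_swap]
  · rw [setLIntegral_congr_fun measurableSet_Ioi hscale, lintegral_lintegral_swap]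
    · have hne : ∀ᵐ u : E N, (0 : E N) ≠ u := by simpa using ae_ne_point hN (0 : E N) univ
      rw [lintegral_congr_ae (hne.mono hinner), lintegral_const_mul _ (by fun_prop)]
      congr 1
      rw [← lintegral_add_left_eq_self (μ := (volume : Measure (E N)))
        (fun y => V y * ‖x - y‖ₑ ^ (1 - (N : ℝ))) x]
      simp
    · exact hΦm.aemeasurable
  · exact Measurable.aemeasurable (by fun_prop)

/-- The fundamental theorem of calculus along a segment. -/
lemma enorm_sub_le_lintegral_gradient {N : ℕ} {Ω : Set (E N)} (hΩ : IsOpen Ω) {φ : E N → ℝ}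
    (hφ : ContDiffOn ℝ 1 φ Ω) {x z : E N} {R : ℝ} (hR : 0 ≤ R)
    (hseg : ∀ r ∈ Icc 0 R, x + r • z ∈ Ω) :
    ‖φ (x + R • z) - φ x‖ₑ ≤
      ∫⁻ r in Ioi (0 : ℝ), Ω.indicator (fun y => ‖gradient φ y‖ₑ) (x + r • z) * ‖z‖ₑ := by
  have hd : ∀ r ∈ uIcc 0 R, HasDerivAt (fun r : ℝ => φ (x + r • z))
      (fderiv ℝ φ (x + r • z) z) r := by
    intro r hr
    rw [uIcc_of_le hR] at hr
    have h1 : HasFDerivAt φ (fderiv ℝ φ (x + r • z)) (x + r • z) :=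
      ((hφ.differentiableOn one_ne_zero).differentiableAt
        (hΩ.mem_nhds (hseg r hr))).hasFDerivAt
    have h2 : HasDerivAt (fun r : ℝ => x + r • z) z r := by
      simpa using ((hasDerivAt_id r).smul_const z).const_add x
    exact h1.comp_hasDerivAt r h2
  have hc : ContinuousOn (fun r : ℝ => fderiv ℝ φ (x + r • z) z) (uIcc 0 R) := by
    rw [uIcc_of_le hR]
    have h1 : ContinuousOn (fderiv ℝ φ) Ω := hφ.continuousOn_fderiv_of_isOpen hΩ le_rfl
    exact (h1.comp (by fun_prop) hseg).clm_apply continuousOn_const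
  have hftc := intervalIntegral.integral_eq_sub_of_hasDerivAt hd hc.intervalIntegrable
  simp only [zero_smul, add_zero] at hftc
  rw [← hftc, intervalIntegral.integral_of_le hR]
  calc _ ≤ ∫⁻ r in Ioc 0 R, ‖fderiv ℝ φ (x + r • z) z‖ₑ := enorm_integral_le_lintegral_enorm _
    _ ≤ ∫⁻ r in Ioc 0 R, Ω.indicator (fun y => ‖gradient φ y‖ₑ) (x + r • z) * ‖z‖ₑ := by
        refine setLIntegral_mono' measurableSet_Ioc fun r hr => ?_
        rw [indicator_of_mem (hseg r ⟨hr.1.le, hr.2⟩), enorm_gradient]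
        exact ContinuousLinearMap.le_opENorm _ _
    -- With the gradient cut off outside `Ω`, the whole half-line may be used; the bound no longer
    -- depends on `R` and has the form needed in `lintegral_rays_eq`.
    _ ≤ _ := lintegral_mono_set Ioc_subset_Ioi_self

/-- The potential estimate for functions of class `C¹_c`. -/
theorem enorm_le_potential_of_compactSupport {N : ℕ} (hN : 0 < N) {Ω : Set (E N)}
    {φ : E N → ℝ} (hφ : ContDiff ℝ 1 φ) (hc : HasCompactSupport φ)
    (hsupp : tsupport φ ⊆ Ω) (x : E N) :
    ‖φ x‖ₑ ≤ ENNReal.ofReal (1 / (N * unitBallVol N)) *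
      ∫⁻ y in Ω, ‖gradient φ y‖ₑ * ‖x - y‖ₑ ^ (1 - (N : ℝ)) := by
  have hN0 : (0 : ℝ) < N := Nat.cast_pos.2 hN
  have hω := unitBallVol_pos N
  have hray : ∀ z : E N, (0 : E N) ≠ z →
      ‖φ x‖ₑ ≤ ∫⁻ r in Ioi (0 : ℝ), ‖gradient φ (x + r • z)‖ₑ * ‖z‖ₑ := by
    intro z hz
    have hz0 : 0 < ‖z‖ := norm_pos_iff.2 hz.symm
    obtain ⟨M, hM⟩ := hc.isCompact.isBounded.exists_norm_le
    -- Chosen so that `|x + R z| ≥ |M| + 1`, beyond the support of `φ`.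
    set R := (|M| + 1 + ‖x‖) / ‖z‖ with hR
    have hR0 : 0 ≤ R := by positivity
    have hout : φ (x + R • z) = 0 := by
      by_contra h
      have h1 := hM _ (subset_tsupport φ h)
      have h2 : ‖R • z‖ = |M| + 1 + ‖x‖ := by
        rw [norm_smul, Real.norm_of_nonneg hR0, hR]
        field_simp
      have h3 : ‖R • z‖ ≤ ‖x + R • z‖ + ‖x‖ := by
        simpa using norm_sub_le (x + R • z) x
      linarith [le_abs_self M]
    have := enorm_sub_le_lintegral_gradient isOpen_univ hφ.contDiffOn (x := x) (z := z) hR0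
      (fun _ _ => mem_univ _)
    simpa [hout] using this
  have hball : volume (Metric.closedBall (0 : E N) 1) = ENNReal.ofReal (unitBallVol N) := by
    have : Nonempty (Fin N) := ⟨⟨0, hN⟩⟩
    rw [Measure.addHaar_closedBall_eq_addHaar_ball, volume_ball_eq _ one_pos, one_pow, one_mul]
  -- The ray estimate is integrated over all `z` in the unit ball: the left side acquires `ω_N`, the
  -- right side the factor `1/N`.
  have hmain : ENNReal.ofReal (unitBallVol N) * ‖φ x‖ₑ ≤
      ENNReal.ofReal (1 / N) * ∫⁻ y in Ω, ‖gradient φ y‖ₑ * ‖x - y‖ₑ ^ (1 - (N : ℝ)) := by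
    calc _ = ∫⁻ z in Metric.closedBall (0 : E N) 1, ‖φ x‖ₑ := by
          rw [setLIntegral_const, hball, mul_comm]
      _ ≤ ∫⁻ z in Metric.closedBall (0 : E N) 1,
            ∫⁻ r in Ioi (0 : ℝ), ‖gradient φ (x + r • z)‖ₑ * ‖z‖ₑ :=
          lintegral_mono_ae ((ae_ne_point hN 0 _).mono hray)
      _ = _ := by
          rw [lintegral_rays_eq hN (V := fun y => ‖gradient φ y‖ₑ)
            (measurable_gradient φ).enorm x one_pos, one_pow]
          congr 1
          refine (setLIntegral_eq_of_support_subset ?_).symm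
          intro y hy
          by_contra hyΩ
          apply hy
          have : fderiv ℝ φ y = 0 := by
            by_contra h
            exact hyΩ (hsupp (tsupport_fderiv_subset ℝ (subset_tsupport _ h)))
          have h0 : gradient φ y = 0 := by simp [gradient, this]
          simp [h0]
  calc ‖φ x‖ₑ = ENNReal.ofReal (1 / unitBallVol N) *
        (ENNReal.ofReal (unitBallVol N) * ‖φ x‖ₑ) := by
        rw [← mul_assoc, ← ENNReal.ofReal_mul (by positivity), one_div_mul_cancel hω.ne',
          ENNReal.ofReal_one, one_mul]
    _ ≤ ENNReal.ofReal (1 / unitBallVol N) * (ENNReal.ofReal (1 / N) *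
        ∫⁻ y in Ω, ‖gradient φ y‖ₑ * ‖x - y‖ₑ ^ (1 - (N : ℝ))) := by gcongr
    _ = _ := by
        rw [← mul_assoc, ← ENNReal.ofReal_mul (by positivity)]
        congr 2
        field_simp

/-- On a convex set, the mean over `S` of `|φ(x) - φ|` is bounded by the potential of `|∇φ|`. -/
theorem lintegral_enorm_sub_le_potential {N : ℕ} (hN : 0 < N) {Ω S : Set (E N)}
    (hΩ : IsOpen Ω) (hconv : Convex ℝ Ω) (hbdd : Bornology.IsBounded Ω)
    (hdiam : 0 < Metric.diam Ω) (hSm : MeasurableSet S)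
    (hS : S ⊆ Ω) {φ : E N → ℝ} (hφ : ContDiffOn ℝ 1 φ Ω) {x : E N} (hx : x ∈ Ω) :
    ∫⁻ y in S, ‖φ y - φ x‖ₑ ≤ ENNReal.ofReal (Metric.diam Ω ^ N / N) *
      ∫⁻ y in Ω, ‖gradient φ y‖ₑ * ‖x - y‖ₑ ^ (1 - (N : ℝ)) := by
  set d := Metric.diam Ω with hd
  set V : E N → ENNReal := Ω.indicator (fun y => ‖gradient φ y‖ₑ) with hV
  have hVm : Measurable V := (measurable_gradient φ).enorm.indicator hΩ.measurableSet
  set h : E N → ENNReal := fun z => ∫⁻ r in Ioi (0 : ℝ), V (x + r • z) * ‖z‖ₑ with hh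
  -- With `z = y - x`, convexity keeps the segment from `x` to `y` inside `Ω`, and `|z| ≤ diam Ω`.
  -- The integral over `S` is then enlarged to the full ball of radius `diam Ω`.
  calc ∫⁻ y in S, ‖φ y - φ x‖ₑ ≤
        ∫⁻ y in S, (Metric.closedBall (0 : E N) d).indicator h (-x + y) := by
        refine setLIntegral_mono' hSm fun y hy => ?_
        have hmem : -x + y ∈ Metric.closedBall (0 : E N) d := by
          rw [mem_closedBall_zero_iff, neg_add_eq_sub, ← dist_eq_norm]
          exact Metric.dist_le_diam_of_mem hbdd (hS hy) hx
        rw [indicator_of_mem hmem]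
        have := enorm_sub_le_lintegral_gradient hΩ hφ (x := x) (z := -x + y) zero_le_one
          (fun r hr => by
            rw [neg_add_eq_sub]
            exact hconv.add_smul_sub_mem hx (hS hy) hr)
        simpa only [one_smul, add_neg_cancel_left] using this
    _ ≤ ∫⁻ y, (Metric.closedBall (0 : E N) d).indicator h (-x + y) :=
        setLIntegral_le_lintegral _ _
    _ = ∫⁻ z in Metric.closedBall (0 : E N) d, h z := by
        rw [lintegral_add_left_eq_self (μ := (volume : Measure (E N)))
          ((Metric.closedBall (0 : E N) d).indicator h) (-x),
          lintegral_indicator Metric.isClosed_closedBall.measurableSet]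
    _ = _ := by
        rw [hh, lintegral_rays_eq hN hVm x hdiam, ← lintegral_indicator hΩ.measurableSet]
        congr 1
        refine lintegral_congr fun y => ?_
        by_cases hy : y ∈ Ω <;> simp [hV, hy]

/-! ### The split domain and passage to the closure. -/

section Splitting

variable {N : ℕ} {Ω Ω₁ Ω₂ : Set (E N)} {ρ η : E N → ℝ} {t γ C₁ C₂ : ℝ}

lemma WeightedSplitting.lintegral_le (h : WeightedSplitting Ω Ω₁ Ω₂ ρ η t γ C₁ C₂)
    (f : E N → ENNReal) : ∫⁻ y in Ω, f y ≤ (∫⁻ y in Ω₁, f y) + ∫⁻ y in Ω₂, f y := by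
  have : Ω ≤ᵐ[volume] (Ω₁ ∪ Ω₂ : Set (E N)) := by
    filter_upwards [compl_mem_ae_iff.2 h.null_remainder] with y hy hyΩ
    by_contra hc
    exact hy ⟨hyΩ, hc⟩
  exact (lintegral_mono' (Measure.restrict_mono_ae this) le_rfl).trans
    (lintegral_union_le _ _ _)

lemma WeightedSplitting.energy₁ (h : WeightedSplitting Ω Ω₁ Ω₂ ρ η t γ C₁ C₂) (G : E N → E N) :
    energy Ω₁ ρ G ≤ energy Ω (glue Ω₁ Ω₂ ρ η) G := by
  refine le_of_eq_of_le (setLIntegral_congr_fun h.measurable₁ fun y hy => ?_)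
    (lintegral_mono_set h.subset₁)
  simp [glue, hy, h.disjoint.notMem_of_mem_left hy]

lemma WeightedSplitting.energy₂ (h : WeightedSplitting Ω Ω₁ Ω₂ ρ η t γ C₁ C₂) (G : E N → E N) :
    energy Ω₂ η G ≤ energy Ω (glue Ω₁ Ω₂ ρ η) G := by
  refine le_of_eq_of_le (setLIntegral_congr_fun h.measurable₂ fun y hy => ?_)
    (lintegral_mono_set h.subset₂)
  simp [glue, hy, h.disjoint.notMem_of_mem_right hy]

/-- The potential operator on `Ω` maps `L²(Ω, σ)` to `L^q(Ω)`. -/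
theorem WeightedSplitting.potential_le (h : WeightedSplitting Ω Ω₁ Ω₂ ρ η t γ C₁ C₂)
    (hN : 2 ≤ N) (ht : 1 < t) (hγ : N - 2 * t < γ) (hγ' : γ ≤ N - 2) {G : E N → E N}
    (hG : AEStronglyMeasurable G (volume.restrict Ω)) {q : ℝ} (hq : 1 ≤ q)
    (hqt : q < twoStar N t γ) :
    (∫⁻ x in Ω, (∫⁻ y in Ω, ‖G y‖ₑ * ‖x - y‖ₑ ^ (1 - (N : ℝ))) ^ q) ^ (1 / q) ≤
      ENNReal.ofReal (C₁ ^ (1 / (2 * t)) * CM N t γ q (volume Ω).toReal ^ (1 / conj2 t)) *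
        energy Ω₁ ρ G ^ (1 / 2 : ℝ) +
      ENNReal.ofReal (C₂ ^ (1 / (2 * t)) * CM N t γ q (volume Ω).toReal ^ (1 / conj2 t)) *
        energy Ω₂ η G ^ (1 / 2 : ℝ) := by
  have hmeas : ∀ {U : Set (E N)}, U ⊆ Ω → AEMeasurable
      (fun x => ∫⁻ y in U, ‖G y‖ₑ * ‖x - y‖ₑ ^ (1 - (N : ℝ))) (volume.restrict Ω) := by
    intro U hU
    refine AEMeasurable.lintegral_prod_right'
      (f := fun z : E N × E N => ‖G z.2‖ₑ * ‖z.1 - z.2‖ₑ ^ (1 - (N : ℝ))) ?_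
    exact ((hG.mono_set hU).enorm.comp_quasiMeasurePreserving
      Measure.quasiMeasurePreserving_snd).mul (Measurable.aemeasurable (by fun_prop))
  calc _ ≤ (∫⁻ x in Ω, ((∫⁻ y in Ω₁, ‖G y‖ₑ * ‖x - y‖ₑ ^ (1 - (N : ℝ))) +
        ∫⁻ y in Ω₂, ‖G y‖ₑ * ‖x - y‖ₑ ^ (1 - (N : ℝ))) ^ q) ^ (1 / q) := by
        gcongr with x
        exact h.lintegral_le _
    _ ≤ _ := ENNReal.lintegral_Lp_add_le (hmeas h.subset₁) (hmeas h.subset₂) hq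
    _ ≤ _ := add_le_add
        (weighted_potential_le hN h.isOpen h.finite_volume h.subset₁ ht hγ hγ'
          h.weight_measurable₁ h.const_nonneg₁ h.bound₁ (hG.mono_set h.subset₁).enorm hq hqt)
        (weighted_potential_le hN h.isOpen h.finite_volume h.subset₂ ht hγ hγ'
          h.weight_measurable₂ h.const_nonneg₂ h.bound₂ (hG.mono_set h.subset₂).enorm hq hqt)

/-- The potential estimate is stable under convergence in `H^{1,2}_σ`. -/
theorem WeightedSplitting.potentialEstimate_of_approx
    (h : WeightedSplitting Ω Ω₁ Ω₂ ρ η t γ C₁ C₂)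
    (hN : 2 ≤ N) (ht : 1 < t) (hγ : N - 2 * t < γ) (hγ' : γ ≤ N - 2) {w : E N → ℝ}
    {G : E N → E N} (hw : AEStronglyMeasurable w (volume.restrict Ω))
    (hG : AEStronglyMeasurable G (volume.restrict Ω)) {φ : ℕ → E N → ℝ} {H : ℕ → E N → E N}
    {Chat : ℝ} (hφ : ∀ n, AEStronglyMeasurable (φ n) (volume.restrict Ω))
    (hH : ∀ n, AEStronglyMeasurable (H n) (volume.restrict Ω))
    (hest : ∀ᶠ n in atTop, PotentialEstimate Ω (φ n) (H n) Chat)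
    (hlim : Tendsto (fun n => eLpNorm (fun x => φ n x - w x) 2 (volume.restrict Ω)) atTop (𝓝 0))
    (hlim' : Tendsto (fun n => energy Ω (glue Ω₁ Ω₂ ρ η) (fun x => H n x - G x)) atTop (𝓝 0)) :
    PotentialEstimate Ω w G Chat := by
  set T : (E N → E N) → E N → ENNReal :=
    fun F x => ∫⁻ y in Ω, ‖F y‖ₑ * ‖x - y‖ₑ ^ (1 - (N : ℝ)) with hT
  have hTm : ∀ {F : E N → E N}, AEStronglyMeasurable F (volume.restrict Ω) →
      AEMeasurable (T F) (volume.restrict Ω) := by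
    intro F hF
    refine AEMeasurable.lintegral_prod_right'
      (f := fun z : E N × E N => ‖F z.2‖ₑ * ‖z.1 - z.2‖ₑ ^ (1 - (N : ℝ))) ?_
    exact (hF.enorm.comp_quasiMeasurePreserving
      Measure.quasiMeasurePreserving_snd).mul (Measurable.aemeasurable (by fun_prop))
  set c := ENNReal.ofReal Chat with hc
  -- Subtraction in `ENNReal` is truncated, so `D` is the positive part of the defect in the
  -- estimate: the claim is `D = 0` almost everywhere, and it is proved by showing that the `L²`
  -- norm of `D` vanishes.
  set D : E N → ENNReal := fun x => ‖w x‖ₑ - c * T G x with hD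
  have hDm : AEMeasurable D (volume.restrict Ω) := hw.enorm.sub ((hTm hG).const_mul c)
  -- The exponent `q = 2` is allowed because `2 < 2^*(t)`; this turns convergence of the energies
  -- into `L²` convergence of the potentials.
  obtain ⟨K₁, K₂, hK⟩ : ∃ K₁ K₂ : ℝ, ∀ F : E N → E N,
      AEStronglyMeasurable F (volume.restrict Ω) → (∫⁻ x in Ω, T F x ^ (2 : ℝ)) ^ (1 / 2 : ℝ) ≤
        ENNReal.ofReal K₁ * energy Ω₁ ρ F ^ (1 / 2 : ℝ) +
        ENNReal.ofReal K₂ * energy Ω₂ η F ^ (1 / 2 : ℝ) :=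
    ⟨_, _, fun F hF => h.potential_le hN ht hγ hγ' hF one_le_two
      (two_lt_twoStar hN ht hγ hγ')⟩
  have hbound : ∀ᶠ n in atTop, (∫⁻ x in Ω, D x ^ (2 : ℝ)) ^ (1 / 2 : ℝ) ≤
      eLpNorm (fun x => φ n x - w x) 2 (volume.restrict Ω) +
        c * (ENNReal.ofReal K₁ *
            energy Ω (glue Ω₁ Ω₂ ρ η) (fun x => H n x - G x) ^ (1 / 2 : ℝ) +
          ENNReal.ofReal K₂ *
            energy Ω (glue Ω₁ Ω₂ ρ η) (fun x => H n x - G x) ^ (1 / 2 : ℝ)) := by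
    filter_upwards [hest] with n hn
    have hHG : AEStronglyMeasurable (fun x => H n x - G x) (volume.restrict Ω) := (hH n).sub hG
    have hpt : ∀ᵐ x ∂(volume.restrict Ω),
        D x ≤ ‖φ n x - w x‖ₑ + c * T (fun x => H n x - G x) x := by
      filter_upwards [hn] with x hx
      have h1 : T (H n) x ≤ T (fun x => H n x - G x) x + T G x := by
        have hGm : AEMeasurable (fun y => ‖G y‖ₑ * ‖x - y‖ₑ ^ (1 - (N : ℝ)))
            (volume.restrict Ω) := hG.enorm.mul (Measurable.aemeasurable (by fun_prop))
        simp only [hT]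
        rw [← lintegral_add_right' _ hGm]
        refine lintegral_mono fun y => ?_
        simp only [← add_mul]
        gcongr
        simpa using enorm_add_le (H n y - G y) (G y)
      refine tsub_le_iff_right.2 ?_
      calc ‖w x‖ₑ ≤ ‖φ n x - w x‖ₑ + ‖φ n x‖ₑ := by
            rw [enorm_sub_rev]
            simpa using enorm_add_le (w x - φ n x) (φ n x)
        _ ≤ ‖φ n x - w x‖ₑ + c * (T (fun x => H n x - G x) x + T G x) := by
            gcongr
            exact hx.trans (by gcongr)
        _ = _ := by ring
    calc (∫⁻ x in Ω, D x ^ (2 : ℝ)) ^ (1 / 2 : ℝ)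
        ≤ (∫⁻ x in Ω, (‖φ n x - w x‖ₑ + c * T (fun x => H n x - G x) x) ^ (2 : ℝ)) ^
            (1 / 2 : ℝ) := by
          refine ENNReal.rpow_le_rpow (lintegral_mono_ae ?_) (by norm_num)
          filter_upwards [hpt] with x hx
          gcongr
      _ ≤ _ := ENNReal.lintegral_Lp_add_le ((hφ n).sub hw).enorm ((hTm hHG).const_mul c) one_le_two
      _ ≤ _ := by
          gcongr
          · rw [eLpNorm_eq_lintegral_rpow_enorm_toReal two_ne_zero ENNReal.ofNat_ne_top]
            simp
          · simp only [ENNReal.mul_rpow_of_nonneg _ _ (zero_le_two (α := ℝ))]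
            rw [lintegral_const_mul'' _ ((hTm hHG).pow_const _),
              ENNReal.mul_rpow_of_nonneg _ _ (by norm_num), ← ENNReal.rpow_mul,
              mul_one_div_cancel two_ne_zero, ENNReal.rpow_one]
            refine mul_le_mul_right ((hK _ hHG).trans ?_) _
            gcongr
            · exact h.energy₁ _
            · exact h.energy₂ _
  have hto : Tendsto (fun n => eLpNorm (fun x => φ n x - w x) 2 (volume.restrict Ω) +
        c * (ENNReal.ofReal K₁ *
            energy Ω (glue Ω₁ Ω₂ ρ η) (fun x => H n x - G x) ^ (1 / 2 : ℝ) +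
          ENNReal.ofReal K₂ *
            energy Ω (glue Ω₁ Ω₂ ρ η) (fun x => H n x - G x) ^ (1 / 2 : ℝ))) atTop (𝓝 0) := by
    have he : Tendsto (fun n => energy Ω (glue Ω₁ Ω₂ ρ η) (fun x => H n x - G x) ^ (1 / 2 : ℝ))
        atTop (𝓝 0) := by
      have := (ENNReal.continuous_rpow_const (y := (1 / 2 : ℝ))).tendsto 0 |>.comp hlim'
      rwa [ENNReal.zero_rpow_of_pos (by norm_num)] at this
    have hmul : ∀ {a : ENNReal} {u : ℕ → ENNReal}, a ≠ ⊤ → Tendsto u atTop (𝓝 0) →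
        Tendsto (fun n => a * u n) atTop (𝓝 0) := by
      intro a u ha hu
      simpa using ENNReal.Tendsto.const_mul hu (Or.inr ha)
    have hsum := (hmul (a := ENNReal.ofReal K₁) ENNReal.ofReal_ne_top he).add
      (hmul (a := ENNReal.ofReal K₂) ENNReal.ofReal_ne_top he)
    rw [add_zero] at hsum
    simpa using hlim.add (hmul (a := c) ENNReal.ofReal_ne_top hsum)
  have hzero : (∫⁻ x in Ω, D x ^ (2 : ℝ)) ^ (1 / 2 : ℝ) = 0 :=
    le_antisymm (ge_of_tendsto hto hbound) zero_le
  rw [ENNReal.rpow_eq_zero_iff_of_pos (by norm_num),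
    lintegral_eq_zero_iff' (hDm.pow_const _)] at hzero
  filter_upwards [hzero] with x hx
  have hx : D x ^ (2 : ℝ) = 0 := hx
  rw [ENNReal.rpow_eq_zero_iff_of_pos two_pos] at hx
  exact tsub_eq_zero_iff_le.1 hx

theorem WeightedSplitting.potentialEstimate_of_memH0
    (h : WeightedSplitting Ω Ω₁ Ω₂ ρ η t γ C₁ C₂)
    (hN : 2 ≤ N) (ht : 1 < t) (hγ : N - 2 * t < γ) (hγ' : γ ≤ N - 2) {w : E N → ℝ}
    {G : E N → E N} (hw : MemH0 Ω (glue Ω₁ Ω₂ ρ η) w G) :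
    PotentialEstimate Ω w G (1 / (N * unitBallVol N)) := by
  obtain ⟨φ, hφ, hlim, hlim'⟩ := hw.approx
  refine h.potentialEstimate_of_approx hN ht hγ hγ' hw.memLp.aestronglyMeasurable
    hw.weakGradient.locInt_grad.aestronglyMeasurable
    (fun n => (hφ n).1.continuous.aestronglyMeasurable)
    (fun n => (measurable_gradient (φ n)).aestronglyMeasurable)
    (Eventually.of_forall fun n => Eventually.of_forall fun x => ?_) hlim hlim'
  exact enorm_le_potential_of_compactSupport (by omega) (hφ n).1 (hφ n).2.1
    (hφ n).2.2 x

/-- The approximants need not have mean zero over `S`, so their means `a n` are subtracted. This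
leaves the gradients unchanged, and `a n → 0` because `w` has mean zero and `φ n → w` in `L²`. -/
theorem WeightedSplitting.potentialEstimate_of_convex
    (h : WeightedSplitting Ω Ω₁ Ω₂ ρ η t γ C₁ C₂)
    (hN : 2 ≤ N) (ht : 1 < t) (hγ : N - 2 * t < γ) (hγ' : γ ≤ N - 2) {w : E N → ℝ}
    {G : E N → E N} (hw : MemH Ω (glue Ω₁ Ω₂ ρ η) w G) (hconv : Convex ℝ Ω)
    (hbdd : Bornology.IsBounded Ω) {S : Set (E N)} (hSm : MeasurableSet S) (hS : S ⊆ Ω)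
    (hS0 : volume S ≠ 0) (hmean : ∫ x in S, w x = 0) :
    PotentialEstimate Ω w G (Metric.diam Ω ^ N / (N * (volume S).toReal)) := by
  have hN0 : (0 : ℝ) < N := by positivity
  obtain ⟨φ, hφ, hlim, hlim'⟩ := hw.approx
  simp only [mem_ofPred_eq] at hφ
  have hStop : volume S ≠ ⊤ := measure_ne_top_of_subset hS h.finite_volume
  have hSpos : 0 < (volume S).toReal := ENNReal.toReal_pos hS0 hStop
  have hdiam : 0 < Metric.diam Ω := by
    refine Metric.diam_pos ?_ hbdd
    by_contra hsub
    have : Nonempty (Fin N) := ⟨⟨0, by omega⟩⟩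
    exact hS0 (measure_mono_null hS ((not_nontrivial_iff.1 hsub).measure_zero volume))
  have : Fact (volume Ω < ⊤) := ⟨h.finite_volume.lt_top⟩
  have : Fact (volume S < ⊤) := ⟨hStop.lt_top⟩
  have hφm : ∀ n, AEStronglyMeasurable (φ n) (volume.restrict Ω) := fun n =>
    (hφ n).continuousOn.aestronglyMeasurable h.isOpen.measurableSet
  have hwm := hw.memLp.aestronglyMeasurable
  have hwS : IntegrableOn w S :=
    ((hw.memLp.mono_measure (Measure.restrict_mono_set _ hS)).integrable one_le_two)
  set a : ℕ → ℝ := fun n => (volume S).toReal⁻¹ * ∫ x in S, φ n x with ha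
  -- A `C¹` approximant may fail to be square integrable; convergence gives this only from some
  -- index on, hence the eventual statements below.
  have hfin : ∀ᶠ n in atTop, eLpNorm (fun x => φ n x - w x) 2 (volume.restrict Ω) < ⊤ :=
    (tendsto_order.1 hlim).2 _ ENNReal.zero_lt_top
  have hint : ∀ᶠ n in atTop, IntegrableOn (φ n) S := by
    filter_upwards [hfin] with n hn
    have h1 : MemLp (fun x => φ n x - w x) 2 (volume.restrict Ω) := ⟨(hφm n).sub hwm, hn⟩
    have h2 := ((h1.mono_measure (Measure.restrict_mono_set _ hS)).integrable one_le_two).add hwS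
    exact h2.congr (Eventually.of_forall fun x => by simp)
  have ha_le : ∀ᶠ n in atTop, ‖a n‖ₑ ≤ ‖(volume S).toReal⁻¹‖ₑ *
      (eLpNorm (fun x => φ n x - w x) 2 (volume.restrict Ω) * volume S ^ (1 / 2 : ℝ)) := by
    filter_upwards [hint] with n hn
    have e : a n = (volume S).toReal⁻¹ * ∫ x in S, (φ n x - w x) := by
      rw [integral_sub hn hwS, hmean, sub_zero]
    rw [e, enorm_mul]
    gcongr
    calc _ ≤ ∫⁻ x in S, ‖φ n x - w x‖ₑ := enorm_integral_le_lintegral_enorm _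
      _ = eLpNorm (fun x => φ n x - w x) 1 (volume.restrict S) := by
          rw [eLpNorm_one_eq_lintegral_enorm]
      _ ≤ eLpNorm (fun x => φ n x - w x) 2 (volume.restrict S) *
            (volume.restrict S) univ ^ (1 / (1 : ENNReal).toReal - 1 / (2 : ENNReal).toReal) :=
          eLpNorm_le_eLpNorm_mul_rpow_measure_univ one_le_two
            (((hφm n).sub hwm).mono_set hS)
      _ ≤ _ := by
          rw [Measure.restrict_apply_univ]
          refine mul_le_mul' (eLpNorm_mono_measure _ (Measure.restrict_mono_set _ hS))
            (le_of_eq ?_)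
          norm_num
  have ha0 : Tendsto (fun n => ‖a n‖ₑ) atTop (𝓝 0) := by
    refine tendsto_of_tendsto_of_tendsto_of_le_of_le' tendsto_const_nhds ?_
      (Eventually.of_forall fun _ => zero_le) ha_le
    have h1 := ENNReal.Tendsto.mul_const hlim
      (Or.inr (ENNReal.rpow_ne_top_of_nonneg (by norm_num : (0 : ℝ) ≤ 1 / 2) hStop))
    have h2 := ENNReal.Tendsto.const_mul h1
      (Or.inr (enorm_ne_top : ‖(volume S).toReal⁻¹‖ₑ ≠ ⊤))
    simpa using h2
  refine h.potentialEstimate_of_approx hN ht hγ hγ' hwm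
    hw.weakGradient.locInt_grad.aestronglyMeasurable (φ := fun n x => φ n x - a n)
    (H := fun n => gradient (φ n)) (fun n => (hφm n).sub aestronglyMeasurable_const)
    (fun n => (measurable_gradient (φ n)).aestronglyMeasurable) ?_ ?_ hlim'
  · filter_upwards [hint] with n hn
    filter_upwards [ae_restrict_mem h.isOpen.measurableSet] with x hx
    have e : φ n x - a n = -((volume S).toReal⁻¹ * ∫ y in S, (φ n y - φ n x)) := by
      rw [integral_sub hn (integrable_const _), integral_const, measureReal_restrict_apply_univ,
        smul_eq_mul, measureReal_def, ha]
      field_simp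
      ring
    rw [e, enorm_neg, enorm_mul]
    calc _ ≤ ‖(volume S).toReal⁻¹‖ₑ * (ENNReal.ofReal (Metric.diam Ω ^ N / N) *
          ∫⁻ y in Ω, ‖gradient (φ n) y‖ₑ * ‖x - y‖ₑ ^ (1 - (N : ℝ))) := by
          gcongr
          exact (enorm_integral_le_lintegral_enorm _).trans
            (lintegral_enorm_sub_le_potential (by omega) h.isOpen hconv hbdd hdiam hSm hS
              (hφ n) hx)
      _ = _ := by
          rw [Real.enorm_of_nonneg (by positivity), ← mul_assoc,
            ← ENNReal.ofReal_mul (by positivity)]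
          congr 2
          field_simp
  · have hconst : ∀ n, eLpNorm (fun _ : E N => a n) 2 (volume.restrict Ω) =
        ‖a n‖ₑ * volume Ω ^ (1 / 2 : ℝ) := fun n => by
      rw [eLpNorm_const' _ two_ne_zero ENNReal.ofNat_ne_top]
      simp
    refine tendsto_of_tendsto_of_tendsto_of_le_of_le tendsto_const_nhds
      (h := fun n => eLpNorm (fun x => φ n x - w x) 2 (volume.restrict Ω) +
        ‖a n‖ₑ * volume Ω ^ (1 / 2 : ℝ)) ?_ (fun _ => zero_le) fun n => ?_
    · have h1 := ENNReal.Tendsto.mul_const ha0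
        (Or.inr (ENNReal.rpow_ne_top_of_nonneg (by norm_num : (0 : ℝ) ≤ 1 / 2) h.finite_volume))
      simpa using hlim.add h1
    · show _ ≤ eLpNorm (fun x => φ n x - w x) 2 (volume.restrict Ω) +
        ‖a n‖ₑ * volume Ω ^ (1 / 2 : ℝ)
      rw [← hconst]
      have := eLpNorm_sub_le (μ := volume.restrict Ω) (p := 2) ((hφm n).sub hwm)
        (aestronglyMeasurable_const (b := a n)) one_le_two
      refine le_trans (le_of_eq ?_) this
      congr 1
      ext x
      simp only [Pi.sub_apply]
      ring

/-- After this the three cases need no further distinction. -/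
theorem WeightedSplitting.potentialEstimate_of_admissible
    (h : WeightedSplitting Ω Ω₁ Ω₂ ρ η t γ C₁ C₂)
    (hN : 2 ≤ N) (ht : 1 < t) (hγ : N - 2 * t < γ) (hγ' : γ ≤ N - 2) {w : E N → ℝ}
    {G : E N → E N} {Chat : ℝ} (hw : Admissible Ω (glue Ω₁ Ω₂ ρ η) w G Chat) :
    0 ≤ Chat ∧ PotentialEstimate Ω w G Chat ∧
      AEStronglyMeasurable w (volume.restrict Ω) ∧
      AEStronglyMeasurable G (volume.restrict Ω) := by
  rcases hw with ⟨hw, rfl⟩ | ⟨hw, hconv, hbdd, S, hSm, hS, hS0, hmean, rfl⟩ | ⟨hw, h0, hest⟩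
  · have := unitBallVol_pos N
    exact ⟨by positivity, h.potentialEstimate_of_memH0 hN ht hγ hγ' hw,
      hw.memLp.aestronglyMeasurable, hw.weakGradient.locInt_grad.aestronglyMeasurable⟩
  · exact ⟨div_nonneg (pow_nonneg Metric.diam_nonneg _) (by positivity),
      h.potentialEstimate_of_convex hN ht hγ hγ' hw hconv hbdd hSm hS hS0 hmean,
      hw.memLp.aestronglyMeasurable, hw.weakGradient.locInt_grad.aestronglyMeasurable⟩
  · exact ⟨h0, hest, hw.memLp.aestronglyMeasurable,
      hw.weakGradient.locInt_grad.aestronglyMeasurable⟩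

end Splitting

/-! ### The Sobolev and Poincaré inequalities. -/

/-- Treats `N = 2` and `N ≥ 3` together: for `N = 2` one has `γ = 0 = N - 2`, which is why the upper
bound is not strict. -/
lemma Exponents.bounds {N : ℕ} {p r γ : ℝ} (h : Exponents N p r γ) (hN : 2 ≤ N) (hp : 2 < p) :
    1 < texp p r ∧ N - 2 * texp p r < γ ∧ γ ≤ N - 2 := by
  have ht : 1 < texp p r := by
    have h1 := h.lower_r
    have hp1 : 0 < p - 1 := by linarith
    have hp2 : 0 < p - 2 := by linarith
    rw [div_lt_iff₀ hp1] at h1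
    rw [texp, div_mul_eq_mul_div, one_lt_div hp2]
    linarith
  rcases hN.eq_or_lt with h2 | h3
  · have hγ := h.two h2.symm
    subst h2
    refine ⟨ht, ?_, ?_⟩ <;> push_cast <;> linarith
  · exact ⟨ht, h.lower_γ h3, (h.upper_γ h3).le⟩

section Splitting

variable {N : ℕ} {Ω Ω₁ Ω₂ : Set (E N)} {ρ η : E N → ℝ} {t γ C₁ C₂ : ℝ}

theorem WeightedSplitting.sobolevIneq (h : WeightedSplitting Ω Ω₁ Ω₂ ρ η t γ C₁ C₂)
    (hN : 2 ≤ N) (ht : 1 < t) (hγ : N - 2 * t < γ) (hγ' : γ ≤ N - 2) {w : E N → ℝ}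
    {G : E N → E N} {Chat : ℝ} (hw : Admissible Ω (glue Ω₁ Ω₂ ρ η) w G Chat) {q : ℝ}
    (hq : 1 ≤ q) (hqt : q < twoStar N t γ) :
    SobolevIneq Ω Ω₁ Ω₂ ρ η t γ C₁ C₂ Chat q w G := by
  obtain ⟨hChat, hest, -, hG⟩ := h.potentialEstimate_of_admissible hN ht hγ hγ' hw
  have hq0 : 0 < q := by linarith
  have hT : AEMeasurable (fun x => ∫⁻ y in Ω, ‖G y‖ₑ * ‖x - y‖ₑ ^ (1 - (N : ℝ)))
      (volume.restrict Ω) := by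
    refine AEMeasurable.lintegral_prod_right'
      (f := fun z : E N × E N => ‖G z.2‖ₑ * ‖z.1 - z.2‖ₑ ^ (1 - (N : ℝ))) ?_
    exact (hG.enorm.comp_quasiMeasurePreserving
      Measure.quasiMeasurePreserving_snd).mul (Measurable.aemeasurable (by fun_prop))
  rw [SobolevIneq, eLpNorm_eq_lintegral_rpow_enorm_toReal (ENNReal.ofReal_pos.2 hq0).ne'
    ENNReal.ofReal_ne_top, ENNReal.toReal_ofReal hq0.le]
  calc (∫⁻ x in Ω, ‖w x‖ₑ ^ q) ^ (1 / q) ≤ (∫⁻ x in Ω, (ENNReal.ofReal Chat *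
        ∫⁻ y in Ω, ‖G y‖ₑ * ‖x - y‖ₑ ^ (1 - (N : ℝ))) ^ q) ^ (1 / q) := by
        refine ENNReal.rpow_le_rpow (lintegral_mono_ae ?_) (by positivity)
        filter_upwards [hest] with x hx
        gcongr
    _ = ENNReal.ofReal Chat *
        (∫⁻ x in Ω, (∫⁻ y in Ω, ‖G y‖ₑ * ‖x - y‖ₑ ^ (1 - (N : ℝ))) ^ q) ^ (1 / q) := by
        simp only [ENNReal.mul_rpow_of_nonneg _ _ hq0.le]
        rw [lintegral_const_mul'' _ (hT.pow_const _),
          ENNReal.mul_rpow_of_nonneg _ _ (by positivity), ← ENNReal.rpow_mul,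
          mul_one_div_cancel hq0.ne', ENNReal.rpow_one]
    _ ≤ _ := mul_le_mul_right (h.potential_le hN ht hγ hγ' hG hq hqt) _
    _ = _ := by
        rw [mul_add, ← mul_assoc, ← mul_assoc, ← ENNReal.ofReal_mul hChat,
          ← ENNReal.ofReal_mul hChat, Cs, Cs, mul_assoc, mul_assoc]

/-- In the constant, `V^{1-2/q}` is the square of the Hölder factor between `L²` and `L^q`, and `2`
comes from `(a + b)² ≤ 2 (a² + b²)`. -/
theorem WeightedSplitting.poincareIneq (h : WeightedSplitting Ω Ω₁ Ω₂ ρ η t γ C₁ C₂)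
    (hN : 2 ≤ N) (ht : 1 < t) (hγ : N - 2 * t < γ) (hγ' : γ ≤ N - 2) {w : E N → ℝ}
    {G : E N → E N} {Chat : ℝ} (hw : Admissible Ω (glue Ω₁ Ω₂ ρ η) w G Chat) {q : ℝ}
    (hq : 2 < q) (hqt : q < twoStar N t γ) :
    PoincareIneq Ω Ω₁ Ω₂ ρ η t γ C₁ C₂ Chat q (fun V => 2 * V ^ (1 - 2 / q)) w G := by
  have hS := h.sobolevIneq hN ht hγ hγ' hw (by linarith : 1 ≤ q) hqt
  obtain ⟨hChat, -, hwm, -⟩ := h.potentialEstimate_of_admissible hN ht hγ hγ' hw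
  have hm := conj2_pos ht
  have hV : 0 ≤ (volume Ω).toReal := ENNReal.toReal_nonneg
  have hCM := CM_nonneg hN ht hγ (by linarith : 1 ≤ q) hqt (muexp_lt_one hN ht hγ') hV
  have hexp : 0 ≤ 1 / 2 - 1 / q := sub_nonneg.2 (one_div_le_one_div_of_le two_pos hq.le)
  have hsq : ∀ {C : ℝ} {e : ENNReal}, 0 ≤ C →
      (ENNReal.ofReal (Cs N t γ q (volume Ω).toReal Chat C) * e ^ (1 / 2 : ℝ)) ^ (2 : ℝ) =
      ENNReal.ofReal (Chat ^ 2) * (ENNReal.ofReal (C ^ (1 / t) *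
        CM N t γ q (volume Ω).toReal ^ (2 / conj2 t)) * e) := by
    intro C e hC
    rw [ENNReal.mul_rpow_of_nonneg _ _ zero_le_two, ← ENNReal.rpow_mul,
      one_div_mul_cancel two_ne_zero, ENNReal.rpow_one, Cs,
      ENNReal.ofReal_rpow_of_nonneg (by positivity) zero_le_two, ← mul_assoc,
      ← ENNReal.ofReal_mul (by positivity)]
    congr 2
    rw [Real.mul_rpow (by positivity) (by positivity), Real.mul_rpow hChat (by positivity),
      ← Real.rpow_mul hC, ← Real.rpow_mul hCM, Real.rpow_two, mul_assoc]
    congr 3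
    · field_simp
    · ring
  have h2 : ∫⁻ x in Ω, ‖w x‖ₑ ^ (2 : ℕ) = eLpNorm w 2 (volume.restrict Ω) ^ (2 : ℝ) := by
    rw [eLpNorm_eq_lintegral_rpow_enorm_toReal two_ne_zero ENNReal.ofNat_ne_top,
      ← ENNReal.rpow_mul]
    simp
  have hcomp : eLpNorm w 2 (volume.restrict Ω) ≤
      eLpNorm w (ENNReal.ofReal q) (volume.restrict Ω) *
        ENNReal.ofReal ((volume Ω).toReal ^ (1 / 2 - 1 / q)) := by
    have hle : (2 : ENNReal) ≤ ENNReal.ofReal q := by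
      rw [← ENNReal.ofReal_ofNat]
      exact ENNReal.ofReal_le_ofReal hq.le
    refine (eLpNorm_le_eLpNorm_mul_rpow_measure_univ hle hwm).trans_eq ?_
    rw [ENNReal.toReal_ofReal (by linarith), Measure.restrict_apply_univ,
      ENNReal.toReal_ofNat, ← ENNReal.ofReal_rpow_of_nonneg hV hexp,
      ENNReal.ofReal_toReal h.finite_volume]
  rw [PoincareIneq, h2]
  calc _ ≤ ((ENNReal.ofReal (Cs N t γ q (volume Ω).toReal Chat C₁) * energy Ω₁ ρ G ^ (1 / 2 : ℝ) +
          ENNReal.ofReal (Cs N t γ q (volume Ω).toReal Chat C₂) * energy Ω₂ η G ^ (1 / 2 : ℝ)) *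
        ENNReal.ofReal ((volume Ω).toReal ^ (1 / 2 - 1 / q))) ^ (2 : ℝ) := by
        gcongr
        exact hcomp.trans (by gcongr; exact hS)
    _ ≤ 2 ^ (2 - 1 : ℝ) *
          ((ENNReal.ofReal (Cs N t γ q (volume Ω).toReal Chat C₁) *
            energy Ω₁ ρ G ^ (1 / 2 : ℝ)) ^ (2 : ℝ) +
          (ENNReal.ofReal (Cs N t γ q (volume Ω).toReal Chat C₂) *
            energy Ω₂ η G ^ (1 / 2 : ℝ)) ^ (2 : ℝ)) *
        ENNReal.ofReal ((volume Ω).toReal ^ (1 / 2 - 1 / q)) ^ (2 : ℝ) := by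
        rw [ENNReal.mul_rpow_of_nonneg _ _ zero_le_two]
        gcongr
        exact ENNReal.rpow_add_le_mul_rpow_add_rpow _ _ one_le_two
    _ = _ := by
        rw [hsq h.const_nonneg₁, hsq h.const_nonneg₂,
          ENNReal.ofReal_rpow_of_nonneg (by positivity) zero_le_two, ← Real.rpow_mul hV,
          show (1 / 2 - 1 / q) * 2 = 1 - 2 / q by ring, ← mul_add,
          ENNReal.ofReal_mul (p := 2 * (volume Ω).toReal ^ (1 - 2 / q)) (by positivity),
          ENNReal.ofReal_mul (p := 2) zero_le_two, ENNReal.ofReal_ofNat, show (2 - 1 : ℝ) = 1 by norm_num, ENNReal.rpow_one]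
        ring

end Splitting

/-! ### Behaviour of the Poincaré constant for small volume. -/

lemma tendsto_two_mul_rpow {q : ℝ} (hq : 2 < q) :
    Tendsto (fun V : ℝ => 2 * V ^ (1 - 2 / q)) (𝓝[>] 0) (𝓝 0) := by
  have hpos : 0 < 1 - 2 / q := sub_pos.2 ((div_lt_one (by linarith)).2 hq)
  have h1 : Tendsto (fun V : ℝ => V ^ (1 - 2 / q)) (𝓝 0) (𝓝 0) := by
    have := (Real.continuous_rpow_const hpos.le).tendsto 0
    rwa [Real.zero_rpow hpos.ne'] at this
  simpa using (h1.mono_left nhdsWithin_le_nhds).const_mul 2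

/-- For `r` close to `1` and `γ` close to `N - 2`, the exponent `q` with
`1 - 2/q = 2θ/((p-1)N)` is admissible. -/
lemma exists_exponent {N : ℕ} (hN : 2 ≤ N) {p θ : ℝ} (hp : 2 < p) (hθ : 0 < θ) (hθ1 : θ < 1) :
    ∃ r₀ : ℝ, r₀ < 1 ∧ ∃ γ₀ : ℝ, γ₀ < N - 2 ∧ ∀ r γ : ℝ, Exponents N p r γ → r₀ < r → γ₀ < γ →
      ∃ q : ℝ, 2 < q ∧ q < twoStar N (texp p r) γ ∧ 1 - 2 / q = 2 * θ / ((p - 1) * N) := by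
  have hp2 : 0 < p - 2 := by linarith
  have hp1 : 0 < p - 1 := by linarith
  have hN2 : (2 : ℝ) ≤ N := by exact_mod_cast hN
  have hN0 : (0 : ℝ) < N := by linarith
  -- Chosen so that `(1 + κ)(p-2)/(p-1) = 1 - θ/(p-1)`. The requirement `q < 2^*(t)` becomes `(N -
  -- γ)/2 < r (1 + κ)`, and the thresholds `γ₀`, `r₀` place `1 + κ/2` strictly between the two
  -- sides.
  set κ := (1 - θ) / (p - 2) with hκ
  have hκ0 : 0 < κ := div_pos (by linarith) hp2
  refine ⟨(1 + κ / 2) / (1 + κ), (div_lt_one (by linarith)).2 (by linarith), N - 2 - κ,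
    by linarith, fun r γ h hr hγ => ?_⟩
  obtain ⟨ht, -, hγ'⟩ := h.bounds hN hp
  set s := 2 * θ / ((p - 1) * N) with hs
  have hs0 : 0 < s := by positivity
  have hs1 : s < 1 := by
    rw [hs, div_lt_one (by positivity)]
    nlinarith
  have h2s : 0 < 1 - s := by linarith
  refine ⟨2 / (1 - s), by rw [lt_div_iff₀ h2s]; linarith, ?_, by field_simp; ring⟩
  rw [← inv_lt_inv₀ (inv_pos.1 (inv_twoStar_pos hN ht hγ')) (by positivity), inv_div, twoStar,
    inv_inv]
  have hr1 : 1 + κ / 2 < r * (1 + κ) := (div_lt_iff₀ (by linarith)).1 hr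
  have key : (N - γ) / (2 * texp p r) < 1 - θ / (p - 1) := by
    have e : 1 - θ / (p - 1) = (1 + κ) * ((p - 2) / (p - 1)) := by
      rw [hκ]
      field_simp
      ring
    rw [e, div_lt_iff₀ (by linarith), texp]
    have : (1 + κ) * ((p - 2) / (p - 1)) * (2 * ((p - 1) / (p - 2) * r)) = 2 * (r * (1 + κ)) := by
      field_simp
    rw [this]
    linarith
  have e1 : 1 / 2 - 1 / (N : ℝ) + 1 / texp p r * (1 / 2 - γ / (2 * N)) =
      1 / 2 - 1 / N + 1 / N * ((N - γ) / (2 * texp p r)) := by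
    have : texp p r ≠ 0 := by linarith
    field_simp
  have e2 : (1 - s) / 2 = 1 / 2 - 1 / N + 1 / N * (1 - θ / (p - 1)) := by
    rw [hs]
    field_simp
    ring
  rw [e1, e2]
  gcongr

end WSobolev

end

theorem mainTheorem7 (N : ℕ) (hN : 2 ≤ N) (p : ℝ) (hp : 2 < p) :
    -- the weighted Sobolev inequality, for all exponents `1 ≤ q < 2^*(t)`
    (∀ r γ : ℝ, WSobolev.Exponents N p r γ →
      ∀ (Ω Ω₁ Ω₂ : Set (WSobolev.E N)) (ρ η : WSobolev.E N → ℝ) (C₁ C₂ : ℝ),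
        WSobolev.WeightedSplitting Ω Ω₁ Ω₂ ρ η (WSobolev.texp p r) γ C₁ C₂ →
        ∀ (w : WSobolev.E N → ℝ) (G : WSobolev.E N → WSobolev.E N) (Chat : ℝ),
          WSobolev.Admissible Ω (WSobolev.glue Ω₁ Ω₂ ρ η) w G Chat →
          ∀ q : ℝ, 1 ≤ q → q < WSobolev.twoStar N (WSobolev.texp p r) γ →
            WSobolev.SobolevIneq Ω Ω₁ Ω₂ ρ η (WSobolev.texp p r) γ C₁ C₂ Chat q w G) ∧
    -- the weighted Poincaré inequality, with a constant that vanishes with `|Ω|`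
    (∀ r γ : ℝ, WSobolev.Exponents N p r γ →
      2 < WSobolev.twoStar N (WSobolev.texp p r) γ ∧
      ∀ q : ℝ, 2 < q → q < WSobolev.twoStar N (WSobolev.texp p r) γ →
        ∃ Cp : ℝ → ℝ, Tendsto Cp (𝓝[>] 0) (𝓝 0) ∧
          ∀ (Ω Ω₁ Ω₂ : Set (WSobolev.E N)) (ρ η : WSobolev.E N → ℝ) (C₁ C₂ : ℝ),
            WSobolev.WeightedSplitting Ω Ω₁ Ω₂ ρ η (WSobolev.texp p r) γ C₁ C₂ →
            ∀ (w : WSobolev.E N → ℝ) (G : WSobolev.E N → WSobolev.E N) (Chat : ℝ),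
              WSobolev.Admissible Ω (WSobolev.glue Ω₁ Ω₂ ρ η) w G Chat →
              WSobolev.PoincareIneq Ω Ω₁ Ω₂ ρ η (WSobolev.texp p r) γ C₁ C₂ Chat q Cp w G) ∧
    -- the rate of the Poincaré constant, for `r` close to `1` and `γ` close to `N - 2`
    (∀ θ : ℝ, 0 < θ → θ < 1 →
      ∃ C : ℝ, 0 < C ∧ ∃ r₀ : ℝ, r₀ < 1 ∧ ∃ γ₀ : ℝ, γ₀ < N - 2 ∧
        ∀ r γ : ℝ, WSobolev.Exponents N p r γ → r₀ < r → γ₀ < γ →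
          ∃ q : ℝ, 2 < q ∧ q < WSobolev.twoStar N (WSobolev.texp p r) γ ∧
            ∀ (Ω Ω₁ Ω₂ : Set (WSobolev.E N)) (ρ η : WSobolev.E N → ℝ) (C₁ C₂ : ℝ),
              WSobolev.WeightedSplitting Ω Ω₁ Ω₂ ρ η (WSobolev.texp p r) γ C₁ C₂ →
              ∀ (w : WSobolev.E N → ℝ) (G : WSobolev.E N → WSobolev.E N) (Chat : ℝ),
                WSobolev.Admissible Ω (WSobolev.glue Ω₁ Ω₂ ρ η) w G Chat →
                WSobolev.PoincareIneq Ω Ω₁ Ω₂ ρ η (WSobolev.texp p r) γ C₁ C₂ Chat q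
                  (fun V => C * V ^ (2 * θ / ((p - 1) * N))) w G) := by
  refine ⟨fun r γ h Ω Ω₁ Ω₂ ρ η C₁ C₂ hS w G Chat hw q hq hqt => ?_, fun r γ h => ?_,
    fun θ hθ hθ1 => ?_⟩
  · obtain ⟨ht, hγ, hγ'⟩ := h.bounds hN hp
    exact hS.sobolevIneq hN ht hγ hγ' hw hq hqt
  · obtain ⟨ht, hγ, hγ'⟩ := h.bounds hN hp
    exact ⟨WSobolev.two_lt_twoStar hN ht hγ hγ', fun q hq hqt =>
      ⟨_, WSobolev.tendsto_two_mul_rpow hq, fun Ω Ω₁ Ω₂ ρ η C₁ C₂ hS w G Chat hw =>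
        hS.poincareIneq hN ht hγ hγ' hw hq hqt⟩⟩
  · obtain ⟨r₀, hr₀, γ₀, hγ₀, H⟩ := WSobolev.exists_exponent hN hp hθ hθ1
    -- The Poincaré constant is already `2 V^{1-2/q}`, and `q` is taken with `1 - 2/q =
    -- 2θ/((p-1)N)`.
    refine ⟨2, two_pos, r₀, hr₀, γ₀, hγ₀, fun r γ h hr hγr => ?_⟩
    obtain ⟨ht, hγ, hγ'⟩ := h.bounds hN hp
    obtain ⟨q, hq, hqt, e⟩ := H r γ h hr hγr
    refine ⟨q, hq, hqt, fun Ω Ω₁ Ω₂ ρ η C₁ C₂ hS w G Chat hw => ?_⟩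
    rw [← e]
    exact hS.poincareIneq hN ht hγ hγ' hw hq hqt
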